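/- Let $n\ge 1$, let $\Omega\subset\mathbb R^n$ be a bounded Lipschitz domain (a nonempty bounded open set whose boundary is locally the graph of a Lipschitz function, with $\Omega$ on one side of it; connectedness is not required), $\Omega_e=\mathbb R^n\setminus\overline\Omega$, $T>0$, $0<s<1$, $m>1$, $0<\lambda\le\Lambda<\infty$, and $\Phi^m(r)=|r|^{m-1}r$. The space $H^s(\mathbb R^n)$ carries the norm $\|f\|_{H^s(\mathbb R^n)}^2=\|f\|_{L^2(\mathbb R^n)}^2+\iint_{\mathbb R^{2n}}\frac{|f(x)-f(y)|^2}{|x-y|^{n+2s}}\,dx\,dy$, $\widetilde H^s(\Omega)$ is the closure of $C_c^\infty(\Omega)$ in $H^s(\mathbb R^n)$, and $H^{-s}(\Omega)$ is the dual of $\widetilde H^s(\Omega)$; a function $f\in L^2(\Omega)$ is identified with the functional $\psi\mapsto\int_\Omega f\psi\,dx$. Let $K:\mathbb R^n\times\mathbb R^n\to\mathbb R$ be measurable with $K(x,y)=K(y,x)$ and $\lambda\le K\le\Lambda$, let $L_K$ be the associated integro-differential operator of order $2s$, and let $$B_K(f,g)=\iint_{\mathbb R^{2n}}K(x,y)\frac{(f(x)-f(y))(g(x)-g(y))}{|x-y|^{n+2s}}\,dx\,dy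 .$$ For $u_0\in L^\infty(\Omega)\cap\widetilde H^s(\Omega)$ and $\varphi\in C_c([0,T]\times\Omega_e)$ (extended by zero) with $\Phi^m(\varphi)\in L^2(0,T;H^s(\mathbb R^n))$, a (weak) solution of $$\partial_t u+L_K(\Phi^m(u))=0\ \text{in }\Omega\times(0,T),\qquad u=\varphi\ \text{in }\Omega_e\times(0,T),\qquad u(0)=u_0\ \text{in }\Omega \tag{1}$$ is a function $u:\mathbb R^n\times(0,T)\to\mathbb R$ with $\Phi^m(u)\in L^2(0,T;H^s(\mathbb R^n))$, $\Phi^m(u-\varphi)\in L^2(0,T;\widetilde H^s(\Omega))$ and $$-\int_{\Omega\times(0,T)}u\,\partial_t\psi\,dx\,dt+\int_0^TB_K(\Phi^m(u),\psi)\,dt=\int_\Omega u_0\,\psi(0)\,dx\qquad\text{for all }\psi\in C_c^\infty([0,T)\times\Omega).$$ **Theorem.** There is a constant $C>0$, depending only on $n,\Omega,T,s,m,\lambda,\Lambda$, such that the following holds. If, for $j=1,2$, $u_{0,j}\in L^\infty(\Omega)\cap\widetilde H^s(\Omega)$, $\varphi_j\in C_c([0,T]\times\Omega_e)$ with $\Phi^m(\varphi_j)\in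 L^2(0,T;H^s(\mathbb R^n))$, and $u_j$ is a solution of (1) with data $(u_{0,j},\varphi_j)$ (with the same $K$), then $$\|u_1-u_2\|_{L^\infty(0,T;H^{-s}(\Omega))}+\|\mathcal U_1-\mathcal U_2\|_{L^\infty(0,T;H^s(\mathbb R^n))}\le C\Big(\|u_{0,1}-u_{0,2}\|_{H^{-s}(\Omega)}+\|\Phi^m(\varphi_1)-\Phi^m(\varphi_2)\|_{L^1(0,T;H^s(\mathbb R^n))}\Big),$$ where $\mathcal U_j(x,t)=\int_0^t\Phi^m(u_j(x,\tau))\,d\tau$. In particular, solutions of (1) are unique: two solutions with the same data $(u_0,\varphi)$ agree almost everywhere in $\mathbb R^n\times(0,T)$. -/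

import Mathlib

open Set MeasureTheory
open scoped ENNReal

noncomputable section

/-- A bounded Lipschitz domain of `ℝⁿ`: a nonempty bounded open set which near each of its boundary
points is, in the direction of some unit vector `e`, the strict subgraph of a Lipschitz function
of the components orthogonal to `e`. Connectedness is not required. -/
structure IsBoundedLipschitzDomain {n : ℕ} (Ω : Set (EuclideanSpace ℝ (Fin n))) : Prop where
  isOpen : IsOpen Ω
  nonempty : Ω.Nonempty
  isBounded : Bornology.IsBounded Ω
  lipschitz_boundary : ∀ x₀ ∈ frontier Ω,
    ∃ (e : EuclideanSpace ℝ (Fin n)) (g : EuclideanSpace ℝ (Fin n) → ℝ) (L : NNReal)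
      (V : Set (EuclideanSpace ℝ (Fin n))),
      ‖e‖ = 1 ∧ LipschitzWith L g ∧ IsOpen V ∧ x₀ ∈ V ∧
        ∀ x ∈ V, x ∈ Ω ↔ inner ℝ x e < g (x - (inner ℝ x e : ℝ) • e)

/-- The exterior `Ω_e = ℝⁿ \ closure Ω`. -/
def exteriorOf {n : ℕ} (Ω : Set (EuclideanSpace ℝ (Fin n))) : Set (EuclideanSpace ℝ (Fin n)) :=
  (closure Ω)ᶜ

/-- The nonlinearity `Φ^m(r) = |r|^(m-1) r`. -/
def porousPhi (m r : ℝ) : ℝ := |r| ^ (m - 1) * r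

/-- The squared Gagliardo seminorm `[f]²` of order `s` on `ℝⁿ`. -/
def gagliardoSq {n : ℕ} (s : ℝ) (f : EuclideanSpace ℝ (Fin n) → ℝ) : ℝ≥0∞ :=
  ∫⁻ p : EuclideanSpace ℝ (Fin n) × EuclideanSpace ℝ (Fin n),
    ENNReal.ofReal ((f p.1 - f p.2) ^ 2 / ‖p.1 - p.2‖ ^ ((n : ℝ) + 2 * s))

/-- The norm of `H^s(ℝⁿ) = W^{s,2}(ℝⁿ)`, with values in `[0, ∞]`. -/
def hsNorm {n : ℕ} (s : ℝ) (f : EuclideanSpace ℝ (Fin n) → ℝ) : ℝ≥0∞ :=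
  ((∫⁻ x, ENNReal.ofReal (f x ^ 2)) + gagliardoSq s f) ^ (1 / 2 : ℝ)

/-- `f ∈ H^s(ℝⁿ)`. -/
def MemHs {n : ℕ} (s : ℝ) (f : EuclideanSpace ℝ (Fin n) → ℝ) : Prop :=
  MemLp f 2 volume ∧ gagliardoSq s f < ∞

/-- `f` belongs to the closure of `C_c^∞(Ω)` in `H^s(ℝⁿ)`. -/
def MemHsTilde {n : ℕ} (Ω : Set (EuclideanSpace ℝ (Fin n))) (s : ℝ)
    (f : EuclideanSpace ℝ (Fin n) → ℝ) : Prop :=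
  MemHs s f ∧ ∀ ε : ℝ, 0 < ε → ∃ ψ : EuclideanSpace ℝ (Fin n) → ℝ,
    ContDiff ℝ (⊤ : ℕ∞) ψ ∧ HasCompactSupport ψ ∧ tsupport ψ ⊆ Ω ∧
      hsNorm s (fun x => f x - ψ x) < ENNReal.ofReal ε

open Classical in
/-- The norm in `H^{-s}(Ω)`, the dual of the closure of `C_c^∞(Ω)` in `H^s(ℝⁿ)`, of the functional
`ψ ↦ ∫_Ω f ψ`; it is `∞` if this integral does not converge absolutely for some `ψ`. -/
def hNegNorm {n : ℕ} (Ω : Set (EuclideanSpace ℝ (Fin n))) (s : ℝ)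
    (f : EuclideanSpace ℝ (Fin n) → ℝ) : ℝ≥0∞ :=
  ⨆ (ψ : EuclideanSpace ℝ (Fin n) → ℝ) (_ : MemHsTilde Ω s ψ) (_ : hsNorm s ψ ≤ 1),
    if IntegrableOn (fun x => f x * ψ x) Ω then ENNReal.ofReal |∫ x in Ω, f x * ψ x| else ∞

/-- `w ∈ L²(0,T;H^s(ℝⁿ))` for a space-time function `w` (time is the first argument).
Since `H^s(ℝⁿ)` is separable, joint measurability of `w` gives the measurability of
`t ↦ w t` as a map into `H^s(ℝⁿ)`. -/
def MemL2Hs {n : ℕ} (T s : ℝ) (w : ℝ → EuclideanSpace ℝ (Fin n) → ℝ) : Prop :=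
  AEStronglyMeasurable (Function.uncurry w) ((volume.restrict (Ioo 0 T)).prod volume) ∧
  (∀ᵐ t ∂volume.restrict (Ioo 0 T), MemHs s (w t)) ∧
  ∫⁻ t in Ioo 0 T, hsNorm s (w t) ^ 2 < ∞

/-- `w ∈ L²(0,T;X)`, where `X` is the closure of `C_c^∞(Ω)` in `H^s(ℝⁿ)`. -/
def MemL2HsTilde {n : ℕ} (Ω : Set (EuclideanSpace ℝ (Fin n))) (T s : ℝ)
    (w : ℝ → EuclideanSpace ℝ (Fin n) → ℝ) : Prop :=
  MemL2Hs T s w ∧ ∀ᵐ t ∂volume.restrict (Ioo 0 T), MemHsTilde Ω s (w t)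

/-- The norm of `L¹(0,T;H^s(ℝⁿ))`. -/
def l1HsNorm {n : ℕ} (T s : ℝ) (w : ℝ → EuclideanSpace ℝ (Fin n) → ℝ) : ℝ≥0∞ :=
  ∫⁻ t in Ioo 0 T, hsNorm s (w t)

/-- The norm of `L^∞(0,T;H^s(ℝⁿ))`. -/
def lInftyHsNorm {n : ℕ} (T s : ℝ) (w : ℝ → EuclideanSpace ℝ (Fin n) → ℝ) : ℝ≥0∞ :=
  essSup (fun t => hsNorm s (w t)) (volume.restrict (Ioo 0 T))

/-- The norm of `L^∞(0,T;H^{-s}(Ω))`. -/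
def lInftyHNegNorm {n : ℕ} (Ω : Set (EuclideanSpace ℝ (Fin n))) (T s : ℝ)
    (w : ℝ → EuclideanSpace ℝ (Fin n) → ℝ) : ℝ≥0∞ :=
  essSup (fun t => hNegNorm Ω s (w t)) (volume.restrict (Ioo 0 T))

/-- The kernels of the operators `L_K` in the class `𝓛₀`, with ellipticity constants `lam`
and `Lam`. -/
structure IsEllipticKernel {n : ℕ} (lam Lam : ℝ)
    (K : EuclideanSpace ℝ (Fin n) → EuclideanSpace ℝ (Fin n) → ℝ) : Prop where
  measurable : Measurable (Function.uncurry K)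
  symm : ∀ x y, K x y = K y x
  lower : ∀ x y, lam ≤ K x y
  upper : ∀ x y, K x y ≤ Lam

/-- The bilinear form `B_K` of `L_K`. -/
def bilinForm {n : ℕ} (s : ℝ) (K : EuclideanSpace ℝ (Fin n) → EuclideanSpace ℝ (Fin n) → ℝ)
    (f g : EuclideanSpace ℝ (Fin n) → ℝ) : ℝ :=
  ∫ p : EuclideanSpace ℝ (Fin n) × EuclideanSpace ℝ (Fin n),
    K p.1 p.2 * ((f p.1 - f p.2) * (g p.1 - g p.2)) / ‖p.1 - p.2‖ ^ ((n : ℝ) + 2 * s)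

/-- Test functions in `C_c^∞([0,T) × Ω)`, given as restrictions of functions in
`C_c^∞((-∞,T) × Ω)`. -/
structure IsTestFunction {n : ℕ} (Ω : Set (EuclideanSpace ℝ (Fin n))) (T : ℝ)
    (ψ : ℝ → EuclideanSpace ℝ (Fin n) → ℝ) : Prop where
  contDiff : ContDiff ℝ (⊤ : ℕ∞) (Function.uncurry ψ)
  hasCompactSupport : HasCompactSupport (Function.uncurry ψ)
  tsupport_subset : tsupport (Function.uncurry ψ) ⊆ Iio T ×ˢ Ω

/-- Exterior conditions: `φ ∈ C_c([0,T] × Ω_e)`, extended by zero to `[0,T] × ℝⁿ`, with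
`Φ^m(φ) ∈ L²(0,T;H^s(ℝⁿ))`. -/
structure IsExteriorDatum {n : ℕ} (Ω : Set (EuclideanSpace ℝ (Fin n))) (T s m : ℝ)
    (φ : ℝ → EuclideanSpace ℝ (Fin n) → ℝ) : Prop where
  continuousOn : ContinuousOn (Function.uncurry φ) (Icc 0 T ×ˢ exteriorOf Ω)
  compact_support : ∃ S : Set (ℝ × EuclideanSpace ℝ (Fin n)), IsCompact S ∧
    S ⊆ Icc 0 T ×ˢ exteriorOf Ω ∧ ∀ t ∈ Icc 0 T, ∀ x, (t, x) ∉ S → φ t x = 0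
  memL2Hs : MemL2Hs T s (fun t x => porousPhi m (φ t x))

/-- Initial data in `L^∞(Ω)` that also belong to the closure of `C_c^∞(Ω)` in `H^s(ℝⁿ)`. -/
structure IsInitialDatum {n : ℕ} (Ω : Set (EuclideanSpace ℝ (Fin n))) (s : ℝ)
    (u₀ : EuclideanSpace ℝ (Fin n) → ℝ) : Prop where
  memLp_top : MemLp u₀ ∞ (volume.restrict Ω)
  memHsTilde : MemHsTilde Ω s u₀

/-- Weak solutions `u : ℝⁿ × (0,T) → ℝ` of `∂_t u + L_K(Φ^m(u)) = 0` in `Ω × (0,T)`, `u = φ` in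
`Ω_e × (0,T)`, `u(0) = u₀` in `Ω`. -/
structure IsWeakSolution {n : ℕ} (Ω : Set (EuclideanSpace ℝ (Fin n))) (T s m : ℝ)
    (K : EuclideanSpace ℝ (Fin n) → EuclideanSpace ℝ (Fin n) → ℝ)
    (u₀ : EuclideanSpace ℝ (Fin n) → ℝ) (φ : ℝ → EuclideanSpace ℝ (Fin n) → ℝ)
    (u : ℝ → EuclideanSpace ℝ (Fin n) → ℝ) : Prop where
  memL2Hs : MemL2Hs T s (fun t x => porousPhi m (u t x))
  exterior : MemL2HsTilde Ω T s (fun t x => porousPhi m (u t x - φ t x))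
  weak_form : ∀ ψ : ℝ → EuclideanSpace ℝ (Fin n) → ℝ, IsTestFunction Ω T ψ →
    -(∫ p in Ioo 0 T ×ˢ Ω, u p.1 p.2 * deriv (fun τ => ψ τ p.2) p.1) +
      (∫ t in Ioo 0 T, bilinForm s K (fun x => porousPhi m (u t x)) (ψ t)) =
    ∫ x in Ω, u₀ x * ψ 0 x

/-- The time primitive `∫₀ᵗ Φ^m(u(x,τ)) dτ`. -/
def timePrimitive {n : ℕ} (m : ℝ) (u : ℝ → EuclideanSpace ℝ (Fin n) → ℝ) (t : ℝ)
    (x : EuclideanSpace ℝ (Fin n)) : ℝ :=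
  ∫ τ in Ioo 0 t, porousPhi m (u τ x)

end

/-!
Send `f ∈ H^s` to the pair of `f` and the kernel-free difference quotient
`(f x - f y) / |x - y| ^ (n / 2 + s)`. This is an isometry of `H^s` into the `L²` space of a
disjoint sum, so everything needed about time integrals of `H^s`-valued functions is a statement
about `L²(0, T; L²)`.

Integrating the equation in time turns a weak solution into
`∫ u(t) f + B_K(𝒰(t), f) = ∫ u₀ f` for almost every `t` and all `f` in `H̃^s(Ω)`. Put
`V = Φ(u₁) - Φ(u₂)`, `g = Φ(φ₁) - Φ(φ₂)` and `U = ∫₀ᵗ V = 𝒰₁ - 𝒰₂`. Subtract the equations of two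
solutions, take `f = V(t) - g(t)` and integrate in `t`: the first term is nonnegative because `Φ` is
monotone, and `∫ B_K(U, V) dt = B_K(U(t), U(t)) / 2` because `V = ∂ₜU`. The Poincaré inequality
bounds the `H^s` norm of `U - ∫₀ᵗ g` by its energy, so that the remaining terms are absorbed into
the supremum of the energy norms. The dual norm of `u₁ - u₂` is then read off the equation.

If the data agree, the dual norm of `u₁ - u₂` vanishes, so `u₁ - u₂` integrates to zero against
`Φ(u₁) - Φ(u₂)`, and the strict monotonicity of `Φ` gives `u₁ = u₂`.
-/

local notation "𝔼" k:max => EuclideanSpace ℝ (Fin k)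

section SquareIntegrable

variable {P : Type*} [MeasurableSpace P] {μ : Measure P}

theorem eLpNorm_two_sq (f : P → ℝ) :
    eLpNorm f 2 μ ^ 2 = ∫⁻ x, ENNReal.ofReal (f x ^ 2) ∂μ := by
  have h := eLpNorm_nnreal_pow_eq_lintegral (f := f) (μ := μ) (p := 2) two_ne_zero
  simp only [NNReal.coe_ofNat, ENNReal.coe_ofNat, ENNReal.rpow_ofNat] at h
  simp only [h, ← Real.enorm_eq_ofReal (sq_nonneg _), enorm_pow]

theorem eLpNorm_two_le_of_measure_le_smul {ν : Measure P} {c : ℝ} (hc : 0 ≤ c)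
    (h : ν ≤ ENNReal.ofReal c • μ) (f : P → ℝ) :
    eLpNorm f 2 ν ≤ ENNReal.ofReal √c * eLpNorm f 2 μ := by
  refine (eLpNorm_le_of_measure_le_smul h).trans_eq ?_
  rw [ENNReal.ofReal_rpow_of_nonneg hc ENNReal.toReal_nonneg, Real.sqrt_eq_rpow]
  simp

theorem abs_integral_mul_le {f g : P → ℝ} (hf : MemLp f 2 μ) (hg : MemLp g 2 μ) :
    |∫ x, f x * g x ∂μ| ≤ (eLpNorm f 2 μ).toReal * (eLpNorm g 2 μ).toReal := by
  have h := abs_real_inner_le_norm (hg.toLp g) (hf.toLp f)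
  rw [Lp.norm_toLp, Lp.norm_toLp, L2.inner_def, mul_comm (ENNReal.toReal _)] at h
  convert h using 2
  refine integral_congr_ae ?_
  filter_upwards [hf.coeFn_toLp, hg.coeFn_toLp] with x hfx hgx
  simp [hfx, hgx]

theorem integral_mul_self_eq {f : P → ℝ} (hf : MemLp f 2 μ) :
    ∫ x, f x * f x ∂μ = (eLpNorm f 2 μ).toReal ^ 2 := by
  have h := real_inner_self_eq_norm_sq (hf.toLp f)
  rw [Lp.norm_toLp, L2.inner_def] at h
  rw [← h]
  refine integral_congr_ae ?_
  filter_upwards [hf.coeFn_toLp] with x hfx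
  simp [hfx, pow_two]

theorem integral_sub_mul_of_memLp_two {f g h : P → ℝ} (hf : MemLp f 2 μ) (hg : MemLp g 2 μ)
    (hh : MemLp h 2 μ) :
    ∫ x, (f x - g x) * h x ∂μ = ∫ x, f x * h x ∂μ - ∫ x, g x * h x ∂μ := by
  simp only [sub_mul]
  exact integral_sub (hf.integrable_mul hh) (hg.integrable_mul hh)

theorem lintegral_enorm_mul_enorm_le {f g : P → ℝ} (hf : AEStronglyMeasurable f μ)
    (hg : AEStronglyMeasurable g μ) :
    ∫⁻ p, ‖f p‖ₑ * ‖g p‖ₑ ∂μ ≤ eLpNorm f 2 μ * eLpNorm g 2 μ := by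
  have h := ENNReal.lintegral_mul_le_Lp_mul_Lq μ Real.HolderConjugate.two_two hf.enorm hg.enorm
  simpa [eLpNorm_eq_lintegral_rpow_enorm_toReal] using h

variable {R : Type*} [MeasurableSpace R] {ρ : Measure R} [SFinite μ]

theorem lintegral_eLpNorm_two_sq {f : R → P → ℝ}
    (hf : AEStronglyMeasurable (Function.uncurry f) (ρ.prod μ)) :
    ∫⁻ t, eLpNorm (f t) 2 μ ^ 2 ∂ρ = eLpNorm (Function.uncurry f) 2 (ρ.prod μ) ^ 2 := by
  rw [eLpNorm_two_sq, lintegral_prod _ (hf.aemeasurable.pow_const 2).ennreal_ofReal]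
  exact lintegral_congr fun t => eLpNorm_two_sq _

theorem aemeasurable_eLpNorm_two {f : R → P → ℝ}
    (hf : AEStronglyMeasurable (Function.uncurry f) (ρ.prod μ)) :
    AEMeasurable (fun t => eLpNorm (f t) 2 μ) ρ := by
  have hsq : AEMeasurable (fun t => eLpNorm (f t) 2 μ ^ 2) ρ := by
    simp_rw [eLpNorm_two_sq]
    exact (hf.aemeasurable.pow_const 2).ennreal_ofReal.lintegral_prod_right'
  refine (hsq.pow_const (1 / 2 : ℝ)).congr (.of_forall fun t => ?_)
  dsimp only
  rw [← ENNReal.rpow_natCast, ← ENNReal.rpow_mul]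
  norm_num

theorem memLp_two_uncurry_iff {f : R → P → ℝ}
    (hf : AEStronglyMeasurable (Function.uncurry f) (ρ.prod μ)) :
    MemLp (Function.uncurry f) 2 (ρ.prod μ) ↔ ∫⁻ t, eLpNorm (f t) 2 μ ^ 2 ∂ρ < ∞ := by
  simp [lintegral_eLpNorm_two_sq hf, MemLp, hf, ENNReal.pow_lt_top_iff]

theorem ae_memLp_of_memLp_uncurry {f : R → P → ℝ}
    (hf : MemLp (Function.uncurry f) 2 (ρ.prod μ)) : ∀ᵐ t ∂ρ, MemLp (f t) 2 μ := by
  have hfin := (memLp_two_uncurry_iff hf.1).1 hf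
  filter_upwards [ae_lt_top' ((aemeasurable_eLpNorm_two hf.1).pow_const 2) hfin.ne,
    hf.1.prodMk_left] with t ht hmeas
  exact ⟨hmeas, by simpa [ENNReal.pow_lt_top_iff] using ht⟩

theorem memLp_uncurry_const [IsFiniteMeasure ρ] {q : P → ℝ} (hq : MemLp q 2 μ) :
    MemLp (Function.uncurry fun _ : R => q) 2 (ρ.prod μ) := by
  rw [memLp_two_uncurry_iff hq.1.comp_snd, lintegral_const]
  exact ENNReal.mul_lt_top (ENNReal.pow_lt_top hq.2) (measure_lt_top _ _)

theorem ae_prod_eq_of_ae_ae_eq {f g : R × P → ℝ} (hf : AEStronglyMeasurable f (ρ.prod μ))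
    (hg : AEStronglyMeasurable g (ρ.prod μ)) (h : ∀ᵐ t ∂ρ, ∀ᵐ p ∂μ, f (t, p) = g (t, p)) :
    f =ᵐ[ρ.prod μ] g := by
  have hmk : hf.mk f =ᵐ[ρ.prod μ] hg.mk g := by
    refine (Measure.ae_prod_iff_ae_ae (measurableSet_eq_fun
      hf.stronglyMeasurable_mk.measurable hg.stronglyMeasurable_mk.measurable)).2 ?_
    filter_upwards [h, Measure.ae_ae_of_ae_prod hf.ae_eq_mk, Measure.ae_ae_of_ae_prod hg.ae_eq_mk]
      with t ht hft hgt
    filter_upwards [ht, hft, hgt] with p hp hfp hgp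
    rw [← hfp, ← hgp, hp]
  exact hf.ae_eq_mk.trans (hmk.trans hg.ae_eq_mk.symm)

theorem integrable_integral_mul {f g : R → P → ℝ}
    (hf : MemLp (Function.uncurry f) 2 (ρ.prod μ))
    (hg : MemLp (Function.uncurry g) 2 (ρ.prod μ)) :
    Integrable (fun t => ∫ p, f t p * g t p ∂μ) ρ :=
  (hf.integrable_mul hg).integral_prod_left

theorem eLpNorm_integral_le [SFinite ρ] {f : R → P → ℝ}
    (hf : AEStronglyMeasurable (Function.uncurry f) (ρ.prod μ)) :
    eLpNorm (fun p => ∫ t, f t p ∂ρ) 2 μ ≤ ∫⁻ t, eLpNorm (f t) 2 μ ∂ρ := by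
  have hslice : ∀ᵐ t ∂ρ, AEStronglyMeasurable (f t) μ := hf.prodMk_left
  have hslice' : ∀ᵐ p ∂μ, AEStronglyMeasurable (fun t => f t p) ρ := hf.prod_swap.prodMk_left
  have hnorm := aemeasurable_eLpNorm_two hf
  have hfst : AEStronglyMeasurable (fun z : (R × R) × P => f z.1.1 z.2) ((ρ.prod ρ).prod μ) :=
    hf.comp_quasiMeasurePreserving
      (QuasiMeasurePreserving.prodMap Measure.quasiMeasurePreserving_fst (.id μ))
  have hsnd : AEStronglyMeasurable (fun z : (R × R) × P => f z.1.2 z.2) ((ρ.prod ρ).prod μ) :=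
    hf.comp_quasiMeasurePreserving
      (QuasiMeasurePreserving.prodMap Measure.quasiMeasurePreserving_snd (.id μ))
  rw [← ENNReal.pow_le_pow_left_iff two_ne_zero]
  calc eLpNorm (fun p => ∫ t, f t p ∂ρ) 2 μ ^ 2
      = ∫⁻ p, ‖∫ t, f t p ∂ρ‖ₑ ^ 2 ∂μ := by
        simp only [eLpNorm_two_sq, ← Real.enorm_eq_ofReal (sq_nonneg _), enorm_pow]
    _ ≤ ∫⁻ p, (∫⁻ t, ‖f t p‖ₑ ∂ρ) ^ 2 ∂μ :=
        lintegral_mono fun p => pow_le_pow_left' (enorm_integral_le_lintegral_enorm _) 2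
    _ = ∫⁻ p, ∫⁻ z, ‖f z.1 p‖ₑ * ‖f z.2 p‖ₑ ∂(ρ.prod ρ) ∂μ := by
        refine lintegral_congr_ae ?_
        filter_upwards [hslice'] with p hp
        rw [pow_two, lintegral_prod_mul hp.enorm hp.enorm]
    _ = ∫⁻ z, ∫⁻ p, ‖f z.1 p‖ₑ * ‖f z.2 p‖ₑ ∂μ ∂(ρ.prod ρ) :=
        (lintegral_lintegral_swap (hfst.enorm.mul hsnd.enorm)).symm
    _ ≤ ∫⁻ z, eLpNorm (f z.1) 2 μ * eLpNorm (f z.2) 2 μ ∂(ρ.prod ρ) := by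
        refine lintegral_mono_ae ?_
        filter_upwards [Measure.quasiMeasurePreserving_fst.ae hslice,
          Measure.quasiMeasurePreserving_snd.ae hslice] with z hz₁ hz₂
        exact lintegral_enorm_mul_enorm_le hz₁ hz₂
    _ = (∫⁻ t, eLpNorm (f t) 2 μ ∂ρ) ^ 2 := by
        rw [lintegral_prod_mul hnorm hnorm, pow_two]

theorem lintegral_eLpNorm_two_lt_top [IsFiniteMeasure ρ] {f : R → P → ℝ}
    (hf : MemLp (Function.uncurry f) 2 (ρ.prod μ)) : ∫⁻ t, eLpNorm (f t) 2 μ ∂ρ < ∞ := by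
  have hle : ∀ a : ℝ≥0∞, a ≤ 1 + a ^ 2 := fun a => by
    rcases le_total a 1 with ha | ha
    · exact ha.trans le_self_add
    · exact (le_self_pow₀ ha two_ne_zero).trans le_add_self
  refine (lintegral_mono fun t => hle (eLpNorm (f t) 2 μ)).trans_lt ?_
  rw [lintegral_add_left measurable_const, lintegral_one]
  exact ENNReal.add_lt_top.2 ⟨measure_lt_top _ _, (memLp_two_uncurry_iff hf.1).1 hf⟩

end SquareIntegrable

section DisjointSum

variable {α β : Type*} [MeasurableSpace α] [MeasurableSpace β] {μ : Measure α} {ν : Measure β}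

/-- The measure on `α ⊕ β` which restricts to `μ` on `α` and to `ν` on `β`. -/
noncomputable def disjointSum (μ : Measure α) (ν : Measure β) : Measure (α ⊕ β) :=
  μ.map Sum.inl + ν.map Sum.inr

instance [SFinite μ] [SFinite ν] : SFinite (disjointSum μ ν) := by
  unfold disjointSum; infer_instance

theorem measurableEmbedding_inl : MeasurableEmbedding (Sum.inl : α → α ⊕ β) :=
  ⟨Sum.inl_injective, measurable_inl, fun _ => MeasurableSet.inl_image⟩

theorem measurableEmbedding_inr : MeasurableEmbedding (Sum.inr : β → α ⊕ β) :=
  ⟨Sum.inr_injective, measurable_inr, fun _ => MeasurableSet.inr_image⟩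

theorem measurableSet_generateFrom_image {γ δ : Type*} {f : γ → δ} (hf : f.Injective)
    {C : Set (Set γ)} {D : Set (Set δ)} (hrange : MeasurableSet[.generateFrom D] (range f))
    (hCD : ∀ t ∈ C, f '' t ∈ D) {s : Set γ} (hs : MeasurableSet[.generateFrom C] s) :
    MeasurableSet[.generateFrom D] (f '' s) := by
  induction s, hs using MeasurableSpace.generateFrom_induction with
  | hC t ht _ => exact MeasurableSpace.measurableSet_generateFrom (hCD t ht)
  | empty => rw [image_empty]; exact @MeasurableSet.empty _ (.generateFrom D)
  | compl t _ ht => rw [← range_sdiff_image hf]; exact hrange.diff ht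
  | iUnion t _ ht => rw [image_iUnion]; exact .iUnion ht

instance [MeasurableSpace.CountablyGenerated α] [MeasurableSpace.CountablyGenerated β] :
    MeasurableSpace.CountablyGenerated (α ⊕ β) := by
  set A := MeasurableSpace.countableGeneratingSet α
  set B := MeasurableSpace.countableGeneratingSet β
  set D : Set (Set (α ⊕ β)) := insert (range Sum.inl) ((Sum.inl '' ·) '' A ∪ (Sum.inr '' ·) '' B)
  have hl : MeasurableSet[.generateFrom D] (range (Sum.inl : α → α ⊕ β)) :=
    MeasurableSpace.measurableSet_generateFrom (mem_insert _ _)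
  have hr : MeasurableSet[.generateFrom D] (range (Sum.inr : β → α ⊕ β)) := by
    rw [← compl_range_inl]
    exact hl.compl
  refine ⟨D, ((((MeasurableSpace.countable_countableGeneratingSet).image _).union
    ((MeasurableSpace.countable_countableGeneratingSet).image _)).insert _), le_antisymm ?_ ?_⟩
  · intro s hs
    rw [← image_preimage_inl_union_image_preimage_inr s]
    refine .union (measurableSet_generateFrom_image Sum.inl_injective hl (C := A)
      (fun t ht => .inr (.inl (mem_image_of_mem _ ht))) ?_)
      (measurableSet_generateFrom_image Sum.inr_injective hr (C := B)
      (fun t ht => .inr (.inr (mem_image_of_mem _ ht))) ?_)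
    · rw [MeasurableSpace.generateFrom_countableGeneratingSet]
      exact hs.1
    · rw [MeasurableSpace.generateFrom_countableGeneratingSet]
      exact hs.2
  · refine MeasurableSpace.generateFrom_le ?_
    rintro _ (rfl | ⟨t, ht, rfl⟩ | ⟨t, ht, rfl⟩)
    · exact measurableSet_range_inl
    · exact (MeasurableSpace.measurableSet_countableGeneratingSet ht).inl_image
    · exact (MeasurableSpace.measurableSet_countableGeneratingSet ht).inr_image

theorem ae_disjointSum_iff {p : α ⊕ β → Prop} :
    (∀ᵐ z ∂disjointSum μ ν, p z) ↔ (∀ᵐ x ∂μ, p (.inl x)) ∧ ∀ᵐ y ∂ν, p (.inr y) := by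
  rw [disjointSum, ae_add_measure_iff, measurableEmbedding_inl.ae_map_iff,
    measurableEmbedding_inr.ae_map_iff]

theorem lintegral_disjointSum (f : α ⊕ β → ℝ≥0∞) :
    ∫⁻ z, f z ∂disjointSum μ ν = ∫⁻ x, f (.inl x) ∂μ + ∫⁻ y, f (.inr y) ∂ν := by
  rw [disjointSum, lintegral_add_measure, measurableEmbedding_inl.lintegral_map,
    measurableEmbedding_inr.lintegral_map]

theorem aestronglyMeasurable_disjointSum_iff {f : α ⊕ β → ℝ} :
    AEStronglyMeasurable f (disjointSum μ ν) ↔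
      AEStronglyMeasurable (f ∘ Sum.inl) μ ∧ AEStronglyMeasurable (f ∘ Sum.inr) ν := by
  rw [disjointSum, aestronglyMeasurable_add_measure_iff,
    measurableEmbedding_inl.aestronglyMeasurable_map_iff,
    measurableEmbedding_inr.aestronglyMeasurable_map_iff]

theorem eLpNorm_two_disjointSum_sq (f : α ⊕ β → ℝ) :
    eLpNorm f 2 (disjointSum μ ν) ^ 2 =
      eLpNorm (f ∘ Sum.inl) 2 μ ^ 2 + eLpNorm (f ∘ Sum.inr) 2 ν ^ 2 := by
  simp only [eLpNorm_two_sq, lintegral_disjointSum, Function.comp_apply]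

theorem memLp_two_disjointSum_iff {f : α ⊕ β → ℝ} :
    MemLp f 2 (disjointSum μ ν) ↔ MemLp (f ∘ Sum.inl) 2 μ ∧ MemLp (f ∘ Sum.inr) 2 ν := by
  have hfin : eLpNorm f 2 (disjointSum μ ν) < ∞ ↔
      eLpNorm (f ∘ Sum.inl) 2 μ < ∞ ∧ eLpNorm (f ∘ Sum.inr) 2 ν < ∞ := by
    simpa [ENNReal.pow_lt_top_iff] using
      congrArg (· < ∞) (eLpNorm_two_disjointSum_sq (μ := μ) (ν := ν) f)
  rw [MemLp, MemLp, MemLp, aestronglyMeasurable_disjointSum_iff, hfin]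
  tauto

theorem integral_disjointSum {f : α ⊕ β → ℝ} (hf : Integrable f (disjointSum μ ν)) :
    ∫ z, f z ∂disjointSum μ ν = ∫ x, f (.inl x) ∂μ + ∫ y, f (.inr y) ∂ν := by
  rw [disjointSum] at hf ⊢
  rw [integral_add_measure hf.left_of_add_measure hf.right_of_add_measure,
    measurableEmbedding_inl.integral_map, measurableEmbedding_inr.integral_map]

theorem prod_disjointSum {R : Type*} [MeasurableSpace R] (ρ : Measure R) [SFinite ρ] [SFinite μ]
    [SFinite ν] :
    ρ.prod (disjointSum μ ν) = (ρ.prod μ).map (Prod.map id Sum.inl) +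
      (ρ.prod ν).map (Prod.map id Sum.inr) := by
  rw [disjointSum, Measure.prod_add, ← Measure.map_prod_map _ _ measurable_id measurable_inl,
    ← Measure.map_prod_map _ _ measurable_id measurable_inr, Measure.map_id]

theorem aestronglyMeasurable_prod_disjointSum_iff {R : Type*} [MeasurableSpace R] {ρ : Measure R}
    [SFinite ρ] [SFinite μ] [SFinite ν] {f : R → α ⊕ β → ℝ} :
    AEStronglyMeasurable (Function.uncurry f) (ρ.prod (disjointSum μ ν)) ↔
      AEStronglyMeasurable (Function.uncurry fun t x => f t (.inl x)) (ρ.prod μ) ∧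
        AEStronglyMeasurable (Function.uncurry fun t y => f t (.inr y)) (ρ.prod ν) := by
  rw [prod_disjointSum, aestronglyMeasurable_add_measure_iff,
    (MeasurableEmbedding.id.prodMap measurableEmbedding_inl).aestronglyMeasurable_map_iff,
    (MeasurableEmbedding.id.prodMap measurableEmbedding_inr).aestronglyMeasurable_map_iff]
  rfl

theorem memLp_two_prod_disjointSum_iff {R : Type*} [MeasurableSpace R] {ρ : Measure R} [SFinite ρ]
    [SFinite μ] [SFinite ν] {f : R → α ⊕ β → ℝ} :
    MemLp (Function.uncurry f) 2 (ρ.prod (disjointSum μ ν)) ↔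
      MemLp (Function.uncurry fun t x => f t (.inl x)) 2 (ρ.prod μ) ∧
        MemLp (Function.uncurry fun t y => f t (.inr y)) 2 (ρ.prod ν) := by
  by_cases hf : AEStronglyMeasurable (Function.uncurry f) (ρ.prod (disjointSum μ ν))
  · obtain ⟨hl, hr⟩ := aestronglyMeasurable_prod_disjointSum_iff.1 hf
    rw [memLp_two_uncurry_iff hf, memLp_two_uncurry_iff hl, memLp_two_uncurry_iff hr,
      ← ENNReal.add_lt_top, ← lintegral_add_left' ((aemeasurable_eLpNorm_two hl).pow_const 2)]
    simp only [eLpNorm_two_disjointSum_sq, Function.comp_def]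
  · exact iff_of_false (fun h => hf h.1)
      fun h => hf (aestronglyMeasurable_prod_disjointSum_iff.2 ⟨h.1.1, h.2.1⟩)

end DisjointSum

theorem intervalIntegral_eq_integral_Ioo {t : ℝ} (ht : 0 ≤ t) (f : ℝ → ℝ) :
    ∫ τ in 0..t, f τ = ∫ τ in Ioo 0 t, f τ := by
  rw [intervalIntegral.integral_of_le ht, integral_Ioc_eq_integral_Ioo]

theorem ae_deriv_intervalIntegral_eq {f : ℝ → ℝ} {a b : ℝ} (hf : IntervalIntegrable f volume a b) :
    ∀ᵐ t, t ∈ uIoc a b → deriv (fun t => ∫ τ in a..t, f τ) t = f t := by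
  filter_upwards [hf.ae_hasDerivAt_integral] with t ht hmem
  exact (ht (uIoc_subset_uIcc hmem) a left_mem_uIcc).deriv

theorem integral_primitive_mul_self {f : ℝ → ℝ} {r : ℝ} (hr : 0 ≤ r)
    (hf : IntegrableOn f (Ioo 0 r)) :
    ∫ t in Ioo 0 r, (∫ τ in Ioo 0 t, f τ) * f t = 2⁻¹ * (∫ τ in Ioo 0 r, f τ) ^ 2 := by
  have hfi : IntervalIntegrable f volume 0 r :=
    (intervalIntegrable_iff_integrableOn_Ioo_of_le hr).2 hf
  have hF := hfi.absolutelyContinuousOnInterval_intervalIntegral (c := 0) left_mem_uIcc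
  have hparts := hF.integral_mul_deriv_eq_deriv_mul hF
  have hderiv : ∫ t in 0..r, (∫ τ in 0..t, f τ) * deriv (fun t => ∫ τ in 0..t, f τ) t =
      ∫ t in 0..r, (∫ τ in 0..t, f τ) * f t :=
    intervalIntegral.integral_congr_ae (by
      filter_upwards [ae_deriv_intervalIntegral_eq hfi] with t ht hmem
      rw [ht hmem])
  have hIoo : ∫ t in Ioo 0 r, (∫ τ in Ioo 0 t, f τ) * f t =
      ∫ t in 0..r, (∫ τ in 0..t, f τ) * f t := by
    rw [intervalIntegral_eq_integral_Ioo hr]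
    refine setIntegral_congr_fun measurableSet_Ioo fun t ht => ?_
    simp only [intervalIntegral_eq_integral_Ioo ht.1.le]
  simp only [mul_comm (deriv _ _), intervalIntegral.integral_same, hderiv] at hparts
  rw [hIoo, ← intervalIntegral_eq_integral_Ioo hr]
  linarith

/-- The primitive `∫₀ᵗ h(τ,p) dτ` of a time dependent function. -/
noncomputable def timeIntegral {P : Type*} (h : ℝ → P → ℝ) (t : ℝ) (p : P) : ℝ :=
  ∫ τ in Ioo 0 t, h τ p

/-- `h ∈ L²(0,T;L²(μ))` for a jointly measurable function `h` (time is the first argument). -/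
abbrev MemL2L2 {P : Type*} [MeasurableSpace P] (T : ℝ) (μ : Measure P) (h : ℝ → P → ℝ) : Prop :=
  MemLp (Function.uncurry h) 2 ((volume.restrict (Ioo 0 T)).prod μ)

section TimeIntegral

variable {P : Type*} [MeasurableSpace P] {μ : Measure P} [SFinite μ] {T r : ℝ} {h : ℝ → P → ℝ}

theorem MemL2L2.mono (hr : r ≤ T) (hh : MemL2L2 T μ h) : MemL2L2 r μ h :=
  hh.mono_measure (Measure.prod_mono (Measure.restrict_mono (Ioo_subset_Ioo_right hr) le_rfl)
    le_rfl)

theorem MemL2L2.ae_memLp (hh : MemL2L2 T μ h) : ∀ᵐ t ∂volume.restrict (Ioo 0 T), MemLp (h t) 2 μ :=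
  ae_memLp_of_memLp_uncurry hh

theorem MemL2L2.ae_integrableOn (hh : MemL2L2 T μ h) :
    ∀ᵐ p ∂μ, IntegrableOn (fun t => h t p) (Ioo 0 T) := by
  have hswap : MemLp (Function.uncurry fun p t => h t p) 2 (μ.prod (volume.restrict (Ioo 0 T))) :=
    hh.comp_measurePreserving Measure.measurePreserving_swap
  filter_upwards [ae_memLp_of_memLp_uncurry hswap] with p hp
  exact hp.integrable one_le_two

theorem MemL2L2.timeIntegral_sub {k : ℝ → P → ℝ} (hh : MemL2L2 r μ h) (hk : MemL2L2 r μ k) :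
    timeIntegral (fun t p => h t p - k t p) r =ᵐ[μ]
      fun p => timeIntegral h r p - timeIntegral k r p := by
  filter_upwards [hh.ae_integrableOn, hk.ae_integrableOn] with p hp hp'
  exact integral_sub hp hp'

theorem eLpNorm_timeIntegral_le (hr : r ≤ T) (hh : MemL2L2 T μ h) :
    eLpNorm (timeIntegral h r) 2 μ ≤ ∫⁻ t in Ioo 0 T, eLpNorm (h t) 2 μ :=
  (eLpNorm_integral_le (hh.mono hr).1).trans
    (lintegral_mono' (Measure.restrict_mono (Ioo_subset_Ioo_right hr) le_rfl) le_rfl)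

theorem MemL2L2.memLp_timeIntegral (hh : MemL2L2 r μ h) : MemLp (timeIntegral h r) 2 μ :=
  ⟨hh.1.prod_swap.integral_prod_right',
    (eLpNorm_timeIntegral_le le_rfl hh).trans_lt (lintegral_eLpNorm_two_lt_top hh)⟩

theorem MemL2L2.aestronglyMeasurable_timeIntegral (hh : MemL2L2 T μ h) :
    AEStronglyMeasurable (Function.uncurry (timeIntegral h))
      ((volume.restrict (Ioo 0 T)).prod μ) := by
  set I : Measure ℝ := volume.restrict (Ioo 0 T)
  have hproj : Measure.QuasiMeasurePreserving (fun z : (ℝ × P) × ℝ => (z.2, z.1.2))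
      ((I.prod μ).prod I) (I.prod μ) :=
    (QuasiMeasurePreserving.prodMap (.id I) Measure.quasiMeasurePreserving_snd).comp
      (Measure.measurePreserving_swap (μ := I.prod μ) (ν := I)).quasiMeasurePreserving
  have hindicator : AEStronglyMeasurable ({z : (ℝ × P) × ℝ | z.2 < z.1.1}.indicator
      fun z => h z.2 z.1.2) ((I.prod μ).prod I) :=
    (hh.1.comp_quasiMeasurePreserving hproj).indicator
      (measurableSet_lt measurable_snd (measurable_fst.comp measurable_fst))
  have htime : ∀ᵐ z ∂(I.prod μ), z.1 ∈ Ioo 0 T :=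
    Measure.quasiMeasurePreserving_fst.ae (ae_restrict_mem measurableSet_Ioo)
  refine hindicator.integral_prod_right'.congr ?_
  filter_upwards [htime] with z hz
  have hslice : (fun τ => {z : (ℝ × P) × ℝ | z.2 < z.1.1}.indicator
      (fun z => h z.2 z.1.2) (z, τ)) = (Iio z.1).indicator fun τ => h τ z.2 := rfl
  rw [hslice, integral_indicator measurableSet_Iio, Measure.restrict_restrict measurableSet_Iio,
    inter_comm, Ioo_inter_Iio, min_eq_right hz.2.le]
  rfl

theorem MemL2L2.timeIntegral (hh : MemL2L2 T μ h) : MemL2L2 T μ (timeIntegral h) := by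
  rw [MemL2L2, memLp_two_uncurry_iff hh.aestronglyMeasurable_timeIntegral]
  have hbound : ∀ t ∈ Ioo 0 T, eLpNorm (_root_.timeIntegral h t) 2 μ ^ 2 ≤
      (∫⁻ t in Ioo 0 T, eLpNorm (h t) 2 μ) ^ 2 := fun t ht =>
    pow_le_pow_left' (eLpNorm_timeIntegral_le ht.2.le hh) 2
  refine (setLIntegral_mono' measurableSet_Ioo hbound).trans_lt ?_
  rw [lintegral_const]
  exact ENNReal.mul_lt_top (ENNReal.pow_lt_top (lintegral_eLpNorm_two_lt_top hh))
    (measure_lt_top _ _)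

theorem integral_timeIntegral_mul (hh : MemL2L2 r μ h) {q : P → ℝ} (hq : MemLp q 2 μ) :
    ∫ p, timeIntegral h r p * q p ∂μ = ∫ t in Ioo 0 r, ∫ p, h t p * q p ∂μ := by
  rw [integral_integral_swap (f := fun t p => h t p * q p)
    (hh.integrable_mul (memLp_uncurry_const hq))]
  exact integral_congr_ae (.of_forall fun p => (integral_mul_const _ _).symm)

theorem integral_timeIntegral_mul_self (hr : 0 ≤ r) (hh : MemL2L2 r μ h) :
    ∫ t in Ioo 0 r, ∫ p, timeIntegral h t p * h t p ∂μ =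
      2⁻¹ * (eLpNorm (timeIntegral h r) 2 μ).toReal ^ 2 := by
  rw [integral_integral_swap (f := fun t p => timeIntegral h t p * h t p)
    (hh.timeIntegral.integrable_mul hh), ← integral_mul_self_eq hh.memLp_timeIntegral,
    ← integral_const_mul]
  refine integral_congr_ae ?_
  filter_upwards [hh.ae_integrableOn] with p hp
  rw [← pow_two]
  exact integral_primitive_mul_self hr hp

theorem exists_mem_timeIntegral_ae_eq {S : Submodule ℝ (Lp ℝ 2 μ)}
    (hS : IsClosed (S : Set (Lp ℝ 2 μ))) (hh : MemL2L2 r μ h)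
    (hmem : ∀ᵐ t ∂volume.restrict (Ioo 0 r), ∃ z ∈ S, z =ᵐ[μ] h t) :
    ∃ z ∈ S, z =ᵐ[μ] timeIntegral h r := by
  have hint := hh.memLp_timeIntegral
  have : CompleteSpace S := hS.completeSpace_coe
  refine ⟨hint.toLp _, ?_, hint.coeFn_toLp⟩
  rw [← S.orthogonal_orthogonal, Submodule.mem_orthogonal]
  intro q hq
  have hinner : inner ℝ q (hint.toLp _) = ∫ p, timeIntegral h r p * q p ∂μ := by
    rw [L2.inner_def]
    refine integral_congr_ae ?_
    filter_upwards [hint.coeFn_toLp] with p hp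
    simp [hp]
  rw [hinner, integral_timeIntegral_mul hh (Lp.memLp q)]
  refine integral_eq_zero_of_ae ?_
  filter_upwards [hmem] with t ⟨z, hz, hzt⟩
  rw [Pi.zero_apply, ← (Submodule.mem_orthogonal S q).1 hq z hz, L2.inner_def]
  refine integral_congr_ae ?_
  filter_upwards [hzt] with p hp
  simp [hp, mul_comm]

end TimeIntegral

section WeakDerivative

variable {T : ℝ}

theorem integrableOn_primitive {b : ℝ → ℝ} (hT : 0 ≤ T) (hb : IntegrableOn b (Ioo 0 T)) :
    IntegrableOn (fun t => ∫ τ in Ioo 0 t, b τ) (Ioo 0 T) := by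
  have hbi : IntervalIntegrable b volume 0 T :=
    (intervalIntegrable_iff_integrableOn_Ioo_of_le hT).2 hb
  have hcont := (hbi.absolutelyContinuousOnInterval_intervalIntegral
    (c := 0) left_mem_uIcc).continuousOn
  rw [uIcc_of_le hT] at hcont
  refine (hcont.integrableOn_Icc.mono_set Ioo_subset_Icc_self).congr_fun (fun t ht => ?_)
    measurableSet_Ioo
  exact intervalIntegral_eq_integral_Ioo ht.1.le b

theorem integral_primitive_mul_deriv {b η : ℝ → ℝ} (hT : 0 ≤ T) (hb : IntegrableOn b (Ioo 0 T))
    (hη : ContDiff ℝ 1 η) (hηT : η T = 0) :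
    ∫ t in Ioo 0 T, (∫ τ in Ioo 0 t, b τ) * deriv η t = -∫ t in Ioo 0 T, η t * b t := by
  have hbi : IntervalIntegrable b volume 0 T :=
    (intervalIntegrable_iff_integrableOn_Ioo_of_le hT).2 hb
  have hparts := (hbi.absolutelyContinuousOnInterval_intervalIntegral
    (c := 0) left_mem_uIcc).integral_mul_deriv_eq_deriv_mul
      hη.contDiffOn.absolutelyContinuousOnInterval
  have hderiv : ∫ t in 0..T, deriv (fun t => ∫ τ in 0..t, b τ) t * η t = ∫ t in 0..T, η t * b t :=
    intervalIntegral.integral_congr_ae (by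
      filter_upwards [ae_deriv_intervalIntegral_eq hbi] with t ht hmem
      rw [ht hmem, mul_comm])
  have hIoo : ∫ t in Ioo 0 T, (∫ τ in Ioo 0 t, b τ) * deriv η t =
      ∫ t in 0..T, (∫ τ in 0..t, b τ) * deriv η t := by
    rw [intervalIntegral_eq_integral_Ioo hT]
    refine setIntegral_congr_fun measurableSet_Ioo fun t ht => ?_
    simp only [intervalIntegral_eq_integral_Ioo ht.1.le]
  rw [hIoo, hparts, hderiv, hηT, intervalIntegral.integral_same,
    ← intervalIntegral_eq_integral_Ioo hT]
  ring

theorem exists_lt_forall_eq_zero_of_tsupport_subset {ζ : ℝ → ℝ} (hc : HasCompactSupport ζ)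
    (hs : tsupport ζ ⊆ Iio T) : ∃ a < T, ∀ t, a < t → ζ t = 0 := by
  obtain ⟨a, ha, hmax⟩ := (hc.isCompact.insert (T - 1)).exists_isGreatest (insert_nonempty _ _)
  refine ⟨a, ?_, fun t ht => ?_⟩
  · rcases ha with rfl | ha
    · linarith
    · exact hs ha
  · by_contra hne
    exact ht.not_ge (hmax (mem_insert_of_mem _ (subset_tsupport _ hne)))

theorem contDiff_intervalIntegral {ζ : ℝ → ℝ} (hζ : ContDiff ℝ (⊤ : ℕ∞) ζ) (c : ℝ) :
    ContDiff ℝ (⊤ : ℕ∞) fun t => ∫ τ in c..t, ζ τ := by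
  rw [contDiff_infty_iff_deriv]
  refine ⟨fun t => (hζ.continuous.integral_hasStrictDerivAt c t).hasDerivAt.differentiableAt, ?_⟩
  rwa [funext fun t => hζ.continuous.deriv_integral ζ c t]

theorem exists_deriv_eq_of_tsupport_subset {ζ : ℝ → ℝ} (hT : 0 < T) (hζ : ContDiff ℝ (⊤ : ℕ∞) ζ)
    (hc : HasCompactSupport ζ) (hs : tsupport ζ ⊆ Iio T) :
    ∃ η : ℝ → ℝ, ContDiff ℝ (⊤ : ℕ∞) η ∧ HasCompactSupport η ∧ tsupport η ⊆ Iio T ∧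
      ∀ t ∈ Ioo 0 T, deriv η t = ζ t := by
  obtain ⟨a, haT, hzero⟩ := exists_lt_forall_eq_zero_of_tsupport_subset hc hs
  set F : ℝ → ℝ := fun t => ∫ τ in T..t, ζ τ
  have hF_zero : ∀ t, a < t → F t = 0 := fun t ht =>
    intervalIntegral.integral_zero_ae (.of_forall fun τ hτ => hzero τ ((lt_min haT ht).trans hτ.1))
  let χ : ContDiffBump (0 : ℝ) := ⟨T, T + 1, hT, by linarith⟩
  refine ⟨fun t => χ t * F t, χ.contDiff.mul (contDiff_intervalIntegral hζ T),
    χ.hasCompactSupport.mul_right, ?_, fun t ht => ?_⟩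
  · refine (closure_minimal (t := Iic a) (fun t ht => ?_) isClosed_Iic).trans (Iic_subset_Iio.2 haT)
    by_contra hat
    exact ht (by simp [hF_zero t (not_le.1 hat)])
  · have hχF : (fun t => χ t * F t) =ᶠ[nhds t] F := by
      filter_upwards [isOpen_Ioo.mem_nhds ht] with τ hτ
      have hmem : τ ∈ Metric.closedBall (0 : ℝ) χ.rIn := by
        rw [mem_closedBall_zero_iff, Real.norm_of_nonneg hτ.1.le]
        exact hτ.2.le
      rw [χ.one_of_mem_closedBall hmem, one_mul]
    rw [hχF.deriv_eq]
    exact hζ.continuous.deriv_integral ζ T t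

theorem ae_eq_const_of_integral_mul_deriv_eq {a : ℝ → ℝ} {c : ℝ} (hT : 0 < T)
    (ha : IntegrableOn a (Ioo 0 T))
    (hweak : ∀ η : ℝ → ℝ, ContDiff ℝ (⊤ : ℕ∞) η → HasCompactSupport η → tsupport η ⊆ Iio T →
      ∫ t in Ioo 0 T, a t * deriv η t = -(c * η 0)) :
    ∀ᵐ t ∂volume.restrict (Ioo 0 T), a t = c := by
  have hac : IntegrableOn (fun t => a t - c) (Ioo 0 T) :=
    Integrable.sub ha (integrable_const c)
  suffices hzero : ∀ᵐ t, t ∈ Ioo 0 T → a t - c = 0 by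
    filter_upwards [ae_restrict_of_ae hzero, ae_restrict_mem measurableSet_Ioo] with t ht hmem
    exact sub_eq_zero.1 (ht hmem)
  refine isOpen_Ioo.ae_eq_zero_of_integral_contDiff_smul_eq_zero hac.locallyIntegrableOn
    fun ζ hζ hc hs => ?_
  obtain ⟨η, hη, hηc, hηs, hderiv⟩ :=
    exists_deriv_eq_of_tsupport_subset hT hζ hc (hs.trans Ioo_subset_Iio_self)
  have hηT : η T = 0 := image_eq_zero_of_notMem_tsupport fun hmem => lt_irrefl T (hηs hmem)
  have hηd : Continuous (deriv η) := hη.continuous_deriv (mod_cast le_top)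
  obtain ⟨M, hM⟩ := hηd.bounded_above_of_compact_support hηc.deriv
  have hηd_int : IntegrableOn (deriv η) (Ioo 0 T) :=
    hηd.integrableOn_Icc.mono_set Ioo_subset_Icc_self
  have hη_int : ∫ t in Ioo 0 T, deriv η t = -η 0 := by
    rw [← intervalIntegral_eq_integral_Ioo hT.le, intervalIntegral.integral_deriv_eq_sub
      (fun t _ => (hη.differentiable (by simp)).differentiableAt)
      (hηd.intervalIntegrable 0 T), hηT, zero_sub]
  calc ∫ t, ζ t • (a t - c)
      = ∫ t in Ioo 0 T, ζ t • (a t - c) := by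
        refine (setIntegral_eq_integral_of_forall_compl_eq_zero fun t ht => ?_).symm
        rw [image_eq_zero_of_notMem_tsupport fun hmem => ht (hs hmem), zero_smul]
    _ = ∫ t in Ioo 0 T, (a t * deriv η t - c * deriv η t) := by
        refine setIntegral_congr_fun measurableSet_Ioo fun t ht => ?_
        simp only [hderiv t ht, smul_eq_mul]
        ring
    _ = 0 := by
        rw [integral_sub (ha.mul_bdd hηd.aestronglyMeasurable (.of_forall hM))
          (hηd_int.const_mul c), integral_const_mul, hη_int, hweak η hη hηc hηs]
        ring

theorem ae_add_integral_eq_of_weak_deriv {a b : ℝ → ℝ} {c : ℝ} (hT : 0 < T)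
    (ha : IntegrableOn a (Ioo 0 T)) (hb : IntegrableOn b (Ioo 0 T))
    (hweak : ∀ η : ℝ → ℝ, ContDiff ℝ (⊤ : ℕ∞) η → HasCompactSupport η → tsupport η ⊆ Iio T →
      -(∫ t in Ioo 0 T, a t * deriv η t) + ∫ t in Ioo 0 T, η t * b t = c * η 0) :
    ∀ᵐ t ∂volume.restrict (Ioo 0 T), a t + ∫ τ in Ioo 0 t, b τ = c := by
  have hB := integrableOn_primitive hT.le hb
  refine ae_eq_const_of_integral_mul_deriv_eq hT (Integrable.add ha hB) fun η hη hηc hηs => ?_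
  have hηT : η T = 0 := image_eq_zero_of_notMem_tsupport fun hmem => lt_irrefl T (hηs hmem)
  have hηd : Continuous (deriv η) := hη.continuous_deriv (mod_cast le_top)
  obtain ⟨M, hM⟩ := hηd.bounded_above_of_compact_support hηc.deriv
  simp only [add_mul]
  rw [integral_add (ha.mul_bdd hηd.aestronglyMeasurable (.of_forall hM))
    (hB.mul_bdd hηd.aestronglyMeasurable (.of_forall hM)),
    integral_primitive_mul_deriv hT.le hb (hη.of_le (mod_cast le_top)) hηT]
  linarith [hweak η hη hηc hηs]

end WeakDerivative

section SobolevGraph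

variable {n : ℕ} {s : ℝ} {f g : 𝔼 n → ℝ}

/-- The difference quotient whose `L²` norm is the Gagliardo seminorm. -/
noncomputable def fracDiff (s : ℝ) (f : 𝔼 n → ℝ) (p : 𝔼 n × 𝔼 n) : ℝ :=
  (f p.1 - f p.2) / ‖p.1 - p.2‖ ^ (((n : ℝ) + 2 * s) / 2)

/-- The embedding `f ↦ (f, fracDiff s f)` of `H^s(ℝⁿ)` into `L²(ℝⁿ) × L²(ℝⁿ × ℝⁿ)`. The pair is
encoded as one function on the disjoint union, so that the embedding is isometric into a space
`L²`. -/
noncomputable def sobolevGraph (s : ℝ) (f : 𝔼 n → ℝ) : 𝔼 n ⊕ (𝔼 n × 𝔼 n) → ℝ :=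
  Sum.elim f (fracDiff s f)

/-- The Lebesgue measure on `ℝⁿ ⊕ (ℝⁿ × ℝⁿ)`, the domain of `sobolevGraph s f`. -/
noncomputable abbrev sobolevMeasure (n : ℕ) : Measure (𝔼 n ⊕ (𝔼 n × 𝔼 n)) :=
  disjointSum volume volume

theorem fracDiff_mul_fracDiff (f g : 𝔼 n → ℝ) (p : 𝔼 n × 𝔼 n) :
    fracDiff s f p * fracDiff s g p =
      (f p.1 - f p.2) * (g p.1 - g p.2) / ‖p.1 - p.2‖ ^ ((n : ℝ) + 2 * s) := by
  have hpow : ‖p.1 - p.2‖ ^ ((n : ℝ) + 2 * s) =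
      ‖p.1 - p.2‖ ^ (((n : ℝ) + 2 * s) / 2) * ‖p.1 - p.2‖ ^ (((n : ℝ) + 2 * s) / 2) := by
    rw [← pow_two, ← Real.rpow_mul_natCast (norm_nonneg _)]
    norm_num
  rw [fracDiff, fracDiff, hpow, div_mul_div_comm]

theorem fracDiff_sub (f g : 𝔼 n → ℝ) :
    fracDiff s (fun x => f x - g x) = fun p => fracDiff s f p - fracDiff s g p := by
  ext p
  simp only [fracDiff]
  ring

theorem fracDiff_const_mul (c : ℝ) (f : 𝔼 n → ℝ) :
    fracDiff s (fun x => c * f x) = fun p => c * fracDiff s f p := by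
  ext p
  simp only [fracDiff]
  ring

theorem sobolevGraph_add (f g : 𝔼 n → ℝ) :
    sobolevGraph s (fun x => f x + g x) = fun z => sobolevGraph s f z + sobolevGraph s g z := by
  ext (x | p)
  · rfl
  · simp only [sobolevGraph, Sum.elim_inr, fracDiff]
    ring

theorem sobolevGraph_sub (f g : 𝔼 n → ℝ) :
    sobolevGraph s (fun x => f x - g x) = fun z => sobolevGraph s f z - sobolevGraph s g z := by
  ext (x | p)
  · rfl
  · exact congrFun (fracDiff_sub f g) p

theorem sobolevGraph_const_mul (c : ℝ) (f : 𝔼 n → ℝ) :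
    sobolevGraph s (fun x => c * f x) = fun z => c * sobolevGraph s f z := by
  ext (x | p)
  · rfl
  · exact congrFun (fracDiff_const_mul c f) p

theorem fracDiff_congr_ae (h : f =ᵐ[volume] g) : fracDiff s f =ᵐ[volume] fracDiff s g := by
  filter_upwards [Measure.quasiMeasurePreserving_fst.ae h,
    Measure.quasiMeasurePreserving_snd.ae h] with p hp₁ hp₂
  simp only [fracDiff, hp₁, hp₂]

theorem sobolevGraph_congr_ae (h : f =ᵐ[volume] g) :
    sobolevGraph s f =ᵐ[sobolevMeasure n] sobolevGraph s g :=
  ae_disjointSum_iff.2 ⟨h, fracDiff_congr_ae h⟩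

theorem gagliardoSq_eq (s : ℝ) (f : 𝔼 n → ℝ) :
    gagliardoSq s f = eLpNorm (fracDiff s f) 2 volume ^ 2 := by
  rw [eLpNorm_two_sq, gagliardoSq]
  simp only [pow_two, fracDiff_mul_fracDiff]

theorem hsNorm_eq_eLpNorm (s : ℝ) (f : 𝔼 n → ℝ) :
    hsNorm s f = eLpNorm (sobolevGraph s f) 2 (sobolevMeasure n) := by
  have hsq : hsNorm s f = (eLpNorm (sobolevGraph s f) 2 (sobolevMeasure n) ^ 2) ^ (1 / 2 : ℝ) := by
    rw [eLpNorm_two_disjointSum_sq, hsNorm, gagliardoSq_eq, ← eLpNorm_two_sq]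
    rfl
  rw [hsq, ← ENNReal.rpow_natCast, ← ENNReal.rpow_mul]
  norm_num

theorem hsNorm_sq (s : ℝ) (f : 𝔼 n → ℝ) :
    hsNorm s f ^ 2 = eLpNorm f 2 volume ^ 2 + eLpNorm (fracDiff s f) 2 volume ^ 2 := by
  rw [hsNorm_eq_eLpNorm, eLpNorm_two_disjointSum_sq]
  rfl

theorem hsNorm_congr_ae (h : f =ᵐ[volume] g) : hsNorm s f = hsNorm s g := by
  rw [hsNorm_eq_eLpNorm, hsNorm_eq_eLpNorm, eLpNorm_congr_ae (sobolevGraph_congr_ae h)]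

theorem eLpNorm_le_hsNorm (s : ℝ) (f : 𝔼 n → ℝ) : eLpNorm f 2 volume ≤ hsNorm s f := by
  rw [← ENNReal.pow_le_pow_left_iff two_ne_zero, hsNorm_sq]
  exact le_self_add

theorem eLpNorm_fracDiff_le_hsNorm (s : ℝ) (f : 𝔼 n → ℝ) :
    eLpNorm (fracDiff s f) 2 volume ≤ hsNorm s f := by
  rw [← ENNReal.pow_le_pow_left_iff two_ne_zero, hsNorm_sq]
  exact le_add_self

theorem hsNorm_le_add (s : ℝ) (f : 𝔼 n → ℝ) :
    hsNorm s f ≤ eLpNorm f 2 volume + eLpNorm (fracDiff s f) 2 volume := by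
  rw [← ENNReal.pow_le_pow_left_iff two_ne_zero, hsNorm_sq, add_sq]
  gcongr
  exact le_self_add

theorem measurable_fracDiff_weight :
    Measurable fun p : 𝔼 n × 𝔼 n => ‖p.1 - p.2‖ ^ (((n : ℝ) + 2 * s) / 2) :=
  (measurable_fst.sub measurable_snd).norm.pow_const _

theorem aestronglyMeasurable_fracDiff (hf : AEStronglyMeasurable f volume) :
    AEStronglyMeasurable (fracDiff s f) volume :=
  ((hf.comp_fst.sub hf.comp_snd).aemeasurable.div
    measurable_fracDiff_weight.aemeasurable).aestronglyMeasurable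

theorem memHs_iff_memLp : MemHs s f ↔ MemLp (sobolevGraph s f) 2 (sobolevMeasure n) := by
  have hfrac : MemLp f 2 volume → (gagliardoSq s f < ∞ ↔ MemLp (fracDiff s f) 2 volume) :=
    fun hf => by simp [gagliardoSq_eq, MemLp, aestronglyMeasurable_fracDiff hf.1]
  rw [memLp_two_disjointSum_iff, MemHs, and_congr_right hfrac]
  rfl

theorem MemHs.memLp_fracDiff (hf : MemHs s f) : MemLp (fracDiff s f) 2 volume :=
  (memLp_two_disjointSum_iff.1 (memHs_iff_memLp.1 hf)).2

theorem MemHs.hsNorm_lt_top (hf : MemHs s f) : hsNorm s f < ∞ := by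
  rw [hsNorm_eq_eLpNorm]
  exact (memHs_iff_memLp.1 hf).2

theorem MemHs.sub (hf : MemHs s f) (hg : MemHs s g) : MemHs s (fun x => f x - g x) := by
  rw [memHs_iff_memLp] at *
  rw [sobolevGraph_sub]
  exact hf.sub hg

theorem hsNorm_le_add_hsNorm_sub (hf : MemHs s f) (hg : MemHs s g) :
    hsNorm s f ≤ hsNorm s (fun x => f x - g x) + hsNorm s g := by
  have hsub := hf.sub hg
  rw [memHs_iff_memLp] at *
  simp only [hsNorm_eq_eLpNorm]
  refine le_trans (le_of_eq ?_) (eLpNorm_add_le hsub.1 hg.1 one_le_two)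
  congr 1
  ext z
  simp [sobolevGraph_sub]

variable {T r : ℝ} {w : ℝ → 𝔼 n → ℝ}

theorem aestronglyMeasurable_uncurry_fracDiff {ρ : Measure ℝ} [SFinite ρ]
    (hw : AEStronglyMeasurable (Function.uncurry w) (ρ.prod volume)) :
    AEStronglyMeasurable (Function.uncurry fun t => fracDiff s (w t)) (ρ.prod volume) := by
  have hfst := hw.comp_quasiMeasurePreserving (QuasiMeasurePreserving.prodMap (.id ρ)
    (Measure.quasiMeasurePreserving_fst (μ := (volume : Measure (𝔼 n)))
      (ν := (volume : Measure (𝔼 n)))))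
  have hsnd := hw.comp_quasiMeasurePreserving (QuasiMeasurePreserving.prodMap (.id ρ)
    (Measure.quasiMeasurePreserving_snd (μ := (volume : Measure (𝔼 n)))
      (ν := (volume : Measure (𝔼 n)))))
  exact ((hfst.sub hsnd).aemeasurable.div
    (measurable_fracDiff_weight.comp measurable_snd).aemeasurable).aestronglyMeasurable

theorem MemL2Hs.memL2L2_sobolevGraph (hw : MemL2Hs T s w) :
    MemL2L2 T (sobolevMeasure n) fun t => sobolevGraph s (w t) := by
  have hmeas := aestronglyMeasurable_prod_disjointSum_iff (f := fun t => sobolevGraph s (w t)).2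
    ⟨hw.1, aestronglyMeasurable_uncurry_fracDiff hw.1⟩
  rw [MemL2L2, memLp_two_uncurry_iff hmeas]
  simpa only [hsNorm_eq_eLpNorm] using hw.2.2

theorem MemL2L2.sobolevGraph_sub {v : ℝ → 𝔼 n → ℝ}
    (hv : MemL2L2 T (sobolevMeasure n) fun t => sobolevGraph s (v t))
    (hw : MemL2L2 T (sobolevMeasure n) fun t => sobolevGraph s (w t)) :
    MemL2L2 T (sobolevMeasure n) fun t => sobolevGraph s (fun x => v t x - w t x) := by
  simp only [_root_.sobolevGraph_sub]
  exact MemLp.sub hv hw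

theorem MemL2L2.of_sobolevGraph (hw : MemL2L2 T (sobolevMeasure n) fun t => sobolevGraph s (w t)) :
    MemL2L2 T volume w :=
  (memLp_two_prod_disjointSum_iff.1 hw).1

theorem MemL2L2.fracDiff_of_sobolevGraph
    (hw : MemL2L2 T (sobolevMeasure n) fun t => sobolevGraph s (w t)) :
    MemL2L2 T volume fun t => fracDiff s (w t) :=
  (memLp_two_prod_disjointSum_iff.1 hw).2

theorem fracDiff_timeIntegral (hw : MemL2L2 r volume w) :
    fracDiff s (timeIntegral w r) =ᵐ[volume] timeIntegral (fun t => fracDiff s (w t)) r := by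
  filter_upwards [Measure.quasiMeasurePreserving_fst.ae hw.ae_integrableOn,
    Measure.quasiMeasurePreserving_snd.ae hw.ae_integrableOn] with p hp₁ hp₂
  simp only [fracDiff, timeIntegral]
  rw [integral_div, integral_sub hp₁ hp₂]

theorem sobolevGraph_timeIntegral (hw : MemL2L2 r volume w) :
    sobolevGraph s (timeIntegral w r) =ᵐ[sobolevMeasure n]
      timeIntegral (fun t => sobolevGraph s (w t)) r :=
  ae_disjointSum_iff.2 ⟨.of_forall fun _ => rfl, fracDiff_timeIntegral hw⟩

theorem hsNorm_timeIntegral_le (hr : r ≤ T)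
    (hw : MemL2L2 T (sobolevMeasure n) fun t => sobolevGraph s (w t)) :
    hsNorm s (timeIntegral w r) ≤ l1HsNorm T s w := by
  rw [hsNorm_eq_eLpNorm, eLpNorm_congr_ae (sobolevGraph_timeIntegral (hw.of_sobolevGraph.mono hr))]
  simpa only [l1HsNorm, hsNorm_eq_eLpNorm] using eLpNorm_timeIntegral_le hr hw

theorem memHs_timeIntegral (hw : MemL2L2 r (sobolevMeasure n) fun t => sobolevGraph s (w t)) :
    MemHs s (timeIntegral w r) :=
  memHs_iff_memLp.2 <|
    hw.memLp_timeIntegral.ae_eq (sobolevGraph_timeIntegral hw.of_sobolevGraph).symm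

end SobolevGraph

section HsTilde

variable {n : ℕ} {s : ℝ} {Ω : Set (𝔼 n)} {f g ψ χ : 𝔼 n → ℝ}

/-- `ψ ∈ C_c^∞(Ω)`. -/
structure IsSpaceTestFunction (Ω : Set (𝔼 n)) (ψ : 𝔼 n → ℝ) : Prop where
  contDiff : ContDiff ℝ (⊤ : ℕ∞) ψ
  hasCompactSupport : HasCompactSupport ψ
  tsupport_subset : tsupport ψ ⊆ Ω

theorem IsSpaceTestFunction.zero : IsSpaceTestFunction Ω (fun _ => 0) :=
  ⟨contDiff_const, .zero, by simp [tsupport, Function.support_fun_zero]⟩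

theorem IsSpaceTestFunction.add (hψ : IsSpaceTestFunction Ω ψ) (hχ : IsSpaceTestFunction Ω χ) :
    IsSpaceTestFunction Ω (fun x => ψ x + χ x) where
  contDiff := hψ.contDiff.add hχ.contDiff
  hasCompactSupport := hψ.hasCompactSupport.add hχ.hasCompactSupport
  tsupport_subset := (tsupport_add ψ χ).trans (union_subset hψ.tsupport_subset hχ.tsupport_subset)

theorem IsSpaceTestFunction.const_mul (hψ : IsSpaceTestFunction Ω ψ) (c : ℝ) :
    IsSpaceTestFunction Ω (fun x => c * ψ x) where
  contDiff := contDiff_const.mul hψ.contDiff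
  hasCompactSupport := hψ.hasCompactSupport.mul_left
  tsupport_subset := (tsupport_mul_subset_right (f := fun _ => c)).trans hψ.tsupport_subset

/-- The image of `C_c^∞(Ω) ∩ H^s(ℝⁿ)` under the isometry `sobolevGraph s`. -/
noncomputable def testSubmodule (Ω : Set (𝔼 n)) (s : ℝ) :
    Submodule ℝ (Lp ℝ 2 (sobolevMeasure n)) where
  carrier := {z | ∃ ψ, IsSpaceTestFunction Ω ψ ∧ z =ᵐ[sobolevMeasure n] sobolevGraph s ψ}
  zero_mem' := by
    refine ⟨_, .zero, (Lp.coeFn_zero ℝ 2 _).trans (.of_eq ?_)⟩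
    ext (_ | _) <;> simp [sobolevGraph, fracDiff]
  add_mem' := by
    rintro y z ⟨ψ, hψ, hy⟩ ⟨χ, hχ, hz⟩
    refine ⟨_, hψ.add hχ, ?_⟩
    rw [sobolevGraph_add]
    exact (Lp.coeFn_add y z).trans (hy.add hz)
  smul_mem' := by
    rintro c z ⟨ψ, hψ, hz⟩
    refine ⟨_, hψ.const_mul c, ?_⟩
    rw [sobolevGraph_const_mul]
    exact (Lp.coeFn_smul c z).trans (hz.const_smul c)

theorem hsNorm_sub_eq_edist {y z : Lp ℝ 2 (sobolevMeasure n)}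
    (hy : y =ᵐ[sobolevMeasure n] sobolevGraph s f) (hz : z =ᵐ[sobolevMeasure n] sobolevGraph s g) :
    hsNorm s (fun x => f x - g x) = edist y z := by
  rw [hsNorm_eq_eLpNorm, sobolevGraph_sub, Lp.edist_def]
  exact eLpNorm_congr_ae (hy.sub hz).symm

theorem memHs_of_ae_eq {z : Lp ℝ 2 (sobolevMeasure n)}
    (hz : z =ᵐ[sobolevMeasure n] sobolevGraph s f) : MemHs s f :=
  memHs_iff_memLp.2 ((Lp.memLp z).ae_eq hz)

theorem IsSpaceTestFunction.memHs_of_hsNorm_sub_lt_top (hψ : IsSpaceTestFunction Ω ψ)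
    (hf : MemHs s f) (hfψ : hsNorm s (fun x => f x - ψ x) < ∞) : MemHs s ψ := by
  have hψ₂ : MemLp ψ 2 volume :=
    hψ.contDiff.continuous.memLp_of_hasCompactSupport hψ.hasCompactSupport
  have hfrac := (eLpNorm_fracDiff_le_hsNorm s _).trans_lt hfψ
  have hsub : MemHs s fun x => f x - ψ x :=
    ⟨hf.1.sub hψ₂, by rw [gagliardoSq_eq]; exact ENNReal.pow_lt_top hfrac⟩
  simpa using hf.sub hsub

theorem memHsTilde_iff : MemHsTilde Ω s f ↔
    ∃ z ∈ (testSubmodule Ω s).topologicalClosure, z =ᵐ[sobolevMeasure n] sobolevGraph s f := by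
  simp only [← SetLike.mem_coe, Submodule.topologicalClosure_coe, Metric.mem_closure_iff]
  constructor
  · rintro ⟨hf, happrox⟩
    have hfz := (memHs_iff_memLp.1 hf).coeFn_toLp
    refine ⟨_, fun ε hε => ?_, hfz⟩
    obtain ⟨ψ, hsmooth, hcompact, hsupp, hψε⟩ := happrox ε hε
    have hψ : IsSpaceTestFunction Ω ψ := ⟨hsmooth, hcompact, hsupp⟩
    have hψz := (memHs_iff_memLp.1 <|
      hψ.memHs_of_hsNorm_sub_lt_top hf (hψε.trans ENNReal.ofReal_lt_top)).coeFn_toLp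
    refine ⟨_, ⟨ψ, hψ, hψz⟩, ?_⟩
    rwa [hsNorm_sub_eq_edist hfz hψz, edist_lt_ofReal] at hψε
  · rintro ⟨z, hz, hzf⟩
    refine ⟨memHs_of_ae_eq hzf, fun ε hε => ?_⟩
    obtain ⟨y, ⟨ψ, hψ, hy⟩, hzy⟩ := hz ε hε
    refine ⟨ψ, hψ.contDiff, hψ.hasCompactSupport, hψ.tsupport_subset, ?_⟩
    rwa [hsNorm_sub_eq_edist hzf hy, edist_lt_ofReal]

theorem MemHsTilde.congr_ae (hf : MemHsTilde Ω s f) (h : f =ᵐ[volume] g) : MemHsTilde Ω s g := by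
  obtain ⟨z, hz, hzf⟩ := memHsTilde_iff.1 hf
  exact memHsTilde_iff.2 ⟨z, hz, hzf.trans (sobolevGraph_congr_ae h)⟩

theorem MemHsTilde.sub (hf : MemHsTilde Ω s f) (hg : MemHsTilde Ω s g) :
    MemHsTilde Ω s (fun x => f x - g x) := by
  obtain ⟨y, hy, hyf⟩ := memHsTilde_iff.1 hf
  obtain ⟨z, hz, hzg⟩ := memHsTilde_iff.1 hg
  refine memHsTilde_iff.2 ⟨y - z, Submodule.sub_mem _ hy hz, ?_⟩
  rw [sobolevGraph_sub]
  exact (Lp.coeFn_sub y z).trans (hyf.sub hzg)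

theorem MemHsTilde.const_mul (hf : MemHsTilde Ω s f) (c : ℝ) :
    MemHsTilde Ω s (fun x => c * f x) := by
  obtain ⟨z, hz, hzf⟩ := memHsTilde_iff.1 hf
  refine memHsTilde_iff.2 ⟨c • z, Submodule.smul_mem _ c hz, ?_⟩
  rw [sobolevGraph_const_mul]
  exact (Lp.coeFn_smul c z).trans (hzf.const_smul c)

theorem MemHsTilde.timeIntegral {r : ℝ} {w : ℝ → 𝔼 n → ℝ}
    (hw : MemL2L2 r (sobolevMeasure n) fun t => sobolevGraph s (w t))
    (htilde : ∀ᵐ t ∂volume.restrict (Ioo 0 r), MemHsTilde Ω s (w t)) :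
    MemHsTilde Ω s (timeIntegral w r) := by
  obtain ⟨z, hz, hzw⟩ := exists_mem_timeIntegral_ae_eq
    (Submodule.isClosed_topologicalClosure (testSubmodule Ω s)) hw
    (htilde.mono fun t ht => memHsTilde_iff.1 ht)
  exact memHsTilde_iff.2 ⟨z, hz, hzw.trans (sobolevGraph_timeIntegral hw.of_sobolevGraph).symm⟩

theorem MemHsTilde.ae_eq_zero (hf : MemHsTilde Ω s f) (hΩ : MeasurableSet Ω) :
    ∀ᵐ x ∂volume.restrict Ωᶜ, f x = 0 := by
  suffices eLpNorm f 2 (volume.restrict Ωᶜ) = 0 from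
    (eLpNorm_eq_zero_iff hf.1.1.1.restrict two_ne_zero).1 this
  refine le_antisymm (ENNReal.le_of_forall_pos_le_add fun ε hε _ => ?_) zero_le
  obtain ⟨ψ, -, -, hsupp, hψε⟩ := hf.2 ε hε
  have heq : f =ᵐ[volume.restrict Ωᶜ] fun x => f x - ψ x := by
    filter_upwards [ae_restrict_mem hΩ.compl] with x hx
    rw [image_eq_zero_of_notMem_tsupport fun h => hx (hsupp h), sub_zero]
  calc eLpNorm f 2 (volume.restrict Ωᶜ)
      = eLpNorm (fun x => f x - ψ x) 2 (volume.restrict Ωᶜ) := eLpNorm_congr_ae heq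
    _ ≤ eLpNorm (fun x => f x - ψ x) 2 volume := eLpNorm_mono_measure _ Measure.restrict_le_self
    _ ≤ hsNorm s (fun x => f x - ψ x) := eLpNorm_le_hsNorm s _
    _ ≤ 0 + ε := by simpa using hψε.le

theorem exists_countable_dense_testFunctions (Ω : Set (𝔼 n)) (s : ℝ) :
    ∃ S : Set (Lp ℝ 2 (sobolevMeasure n)), S.Countable ∧ S ⊆ testSubmodule Ω s ∧
      ((testSubmodule Ω s).topologicalClosure : Set (Lp ℝ 2 (sobolevMeasure n))) ⊆ closure S := by
  have : Fact ((2 : ℝ≥0∞) ≠ ∞) := ⟨ENNReal.ofNat_ne_top⟩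
  have : SFinite (sobolevMeasure n) := inferInstance
  obtain ⟨S, hS, hScount, hSdense⟩ := (TopologicalSpace.IsSeparable.of_separableSpace
    (testSubmodule Ω s : Set (Lp ℝ 2 (sobolevMeasure n)))).exists_countable_dense_subset
  exact ⟨S, hScount, hS, closure_minimal hSdense isClosed_closure⟩

theorem ae_forall_memHsTilde_integral_eq_zero {R : Type*} [MeasurableSpace R] {ρ : Measure R}
    {q : R → 𝔼 n ⊕ (𝔼 n × 𝔼 n) → ℝ} (hq : ∀ᵐ t ∂ρ, MemLp (q t) 2 (sobolevMeasure n))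
    (htest : ∀ ψ, IsSpaceTestFunction Ω ψ → MemHs s ψ →
      ∀ᵐ t ∂ρ, ∫ z, q t z * sobolevGraph s ψ z ∂sobolevMeasure n = 0) :
    ∀ᵐ t ∂ρ, ∀ f, MemHsTilde Ω s f → ∫ z, q t z * sobolevGraph s f z ∂sobolevMeasure n = 0 := by
  obtain ⟨S, hScount, hStest, hSdense⟩ := exists_countable_dense_testFunctions Ω s
  have hS : ∀ᵐ t ∂ρ, ∀ y ∈ S, ∫ z, q t z * y z ∂sobolevMeasure n = 0 := by
    refine (ae_ball_iff hScount).2 fun y hy => ?_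
    obtain ⟨ψ, hψ, hyψ⟩ := hStest hy
    filter_upwards [htest ψ hψ (memHs_of_ae_eq hyψ)] with t ht
    rw [← ht]
    exact integral_congr_ae (hyψ.mono fun z hz => by simp only [hz])
  filter_upwards [hS, hq] with t ht hqt f hf
  obtain ⟨y, hy, hyf⟩ := memHsTilde_iff.1 hf
  have hinner : ∀ y : Lp ℝ 2 (sobolevMeasure n),
      inner ℝ (hqt.toLp _) y = ∫ z, q t z * y z ∂sobolevMeasure n := fun y => by
    rw [L2.inner_def]
    exact integral_congr_ae (hqt.coeFn_toLp.mono fun z hz => by simp [hz, mul_comm])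
  have hclosed : IsClosed {y : Lp ℝ 2 (sobolevMeasure n) | inner ℝ (hqt.toLp _) y = 0} :=
    isClosed_eq (continuous_const.inner continuous_id) continuous_const
  have hzero : inner ℝ (hqt.toLp _) y = 0 :=
    closure_minimal (fun y hy => (hinner y).trans (ht y hy)) hclosed (hSdense hy)
  rw [← hzero, hinner]
  exact integral_congr_ae (hyf.mono fun z hz => by simp only [hz])

end HsTilde

section Coercivity

variable {n : ℕ} {s lam Lam : ℝ} {K : 𝔼 n → 𝔼 n → ℝ} {f g : 𝔼 n → ℝ}

theorem sq_le_rpow_mul_fracDiff_sq {D : ℝ} (hs : 0 ≤ (n : ℝ) + 2 * s) {p : 𝔼 n × 𝔼 n}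
    (hp : ‖p.1 - p.2‖ ≤ D) (hf : f p.2 = 0) :
    f p.1 ^ 2 ≤ D ^ ((n : ℝ) + 2 * s) * fracDiff s f p ^ 2 := by
  rcases eq_or_ne p.1 p.2 with heq | hne
  · rw [heq, hf, zero_pow two_ne_zero]
    exact mul_nonneg (Real.rpow_nonneg ((norm_nonneg _).trans hp) _) (sq_nonneg _)
  have hpos : 0 < ‖p.1 - p.2‖ := norm_pos_iff.2 (sub_ne_zero.2 hne)
  rw [pow_two (fracDiff s f p), fracDiff_mul_fracDiff, hf, sub_zero, mul_div_assoc',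
    le_div_iff₀ (Real.rpow_pos_of_pos hpos _), mul_comm, ← pow_two]
  gcongr

theorem measure_mul_eLpNorm_sq_le_fracDiff {A B : Set (𝔼 n)} {D : ℝ} (hA : MeasurableSet A)
    (hB : MeasurableSet B) (hD : ∀ x ∈ A, ∀ y ∈ B, ‖x - y‖ ≤ D) (hs : 0 ≤ (n : ℝ) + 2 * s)
    (hf : AEStronglyMeasurable f volume) (hfB : ∀ᵐ y ∂volume.restrict B, f y = 0) :
    volume B * eLpNorm f 2 (volume.restrict A) ^ 2 ≤
      ENNReal.ofReal (D ^ ((n : ℝ) + 2 * s)) * eLpNorm (fracDiff s f) 2 volume ^ 2 := by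
  have hpointwise : ∀ᵐ p ∂(volume.restrict A).prod (volume.restrict B), ENNReal.ofReal (f p.1 ^ 2) ≤
      ENNReal.ofReal (D ^ ((n : ℝ) + 2 * s)) * ENNReal.ofReal (fracDiff s f p ^ 2) := by
    filter_upwards [Measure.quasiMeasurePreserving_snd.ae hfB,
      Measure.quasiMeasurePreserving_fst.ae (ae_restrict_mem hA),
      Measure.quasiMeasurePreserving_snd.ae (ae_restrict_mem hB)] with p hp hpA hpB
    rw [← ENNReal.ofReal_mul' (sq_nonneg _)]
    exact ENNReal.ofReal_le_ofReal (sq_le_rpow_mul_fracDiff_sq hs (hD _ hpA _ hpB) hp)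
  calc volume B * eLpNorm f 2 (volume.restrict A) ^ 2
      = ∫⁻ p, ENNReal.ofReal (f p.1 ^ 2) ∂(volume.restrict A).prod (volume.restrict B) := by
        rw [lintegral_prod _ (hf.aemeasurable.restrict.comp_fst.pow_const 2).ennreal_ofReal]
        simp only [lintegral_const, Measure.restrict_apply_univ]
        rw [lintegral_mul_const'' _ (hf.aemeasurable.restrict.pow_const 2).ennreal_ofReal,
          eLpNorm_two_sq, mul_comm]
    _ ≤ ∫⁻ p, ENNReal.ofReal (D ^ ((n : ℝ) + 2 * s)) * ENNReal.ofReal (fracDiff s f p ^ 2)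
          ∂(volume.restrict A).prod (volume.restrict B) := lintegral_mono_ae hpointwise
    _ ≤ ∫⁻ p : 𝔼 n × 𝔼 n,
          ENNReal.ofReal (D ^ ((n : ℝ) + 2 * s)) * ENNReal.ofReal (fracDiff s f p ^ 2) := by
        rw [Measure.prod_restrict]
        exact setLIntegral_le_lintegral _ _
    _ = ENNReal.ofReal (D ^ ((n : ℝ) + 2 * s)) * eLpNorm (fracDiff s f) 2 volume ^ 2 := by
        rw [lintegral_const_mul' _ _ ENNReal.ofReal_ne_top, eLpNorm_two_sq]

theorem exists_ball_subset_compl_of_isBounded {E : Type*} [NormedAddCommGroup E]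
    [NormedSpace ℝ E] [Nontrivial E] {A : Set E} (hA : Bornology.IsBounded A) :
    ∃ (z : E) (D : ℝ), Metric.ball z 1 ⊆ Aᶜ ∧ ∀ x ∈ A, ∀ y ∈ Metric.ball z 1, ‖x - y‖ ≤ D := by
  obtain ⟨R, hR, hAR⟩ := hA.subset_ball_lt 0 0
  obtain ⟨z, hz⟩ := exists_norm_eq E (by linarith : 0 ≤ R + 1)
  have hbounds : ∀ y ∈ Metric.ball z 1, R < ‖y‖ ∧ ‖y‖ < R + 2 := fun y hy => by
    rw [mem_ball_iff_norm] at hy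
    have hle := abs_le.1 (abs_norm_sub_norm_le y z)
    constructor <;> linarith
  refine ⟨z, R + (R + 2), fun y hyz hyA => ?_, fun x hx y hy => ?_⟩
  · exact lt_asymm (hbounds y hyz).1 (mem_ball_zero_iff.1 (hAR hyA))
  · exact (norm_sub_le x y).trans
      (add_le_add (mem_ball_zero_iff.1 (hAR hx)).le (hbounds y hy).2.le)

theorem exists_eLpNorm_le_fracDiff [Nonempty (Fin n)] (hs : 0 ≤ (n : ℝ) + 2 * s) {Ω : Set (𝔼 n)}
    (hΩb : Bornology.IsBounded Ω) (hΩ : MeasurableSet Ω) :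
    ∃ C : ℝ, 0 < C ∧ ∀ f : 𝔼 n → ℝ, AEStronglyMeasurable f volume →
      (∀ᵐ x ∂volume.restrict Ωᶜ, f x = 0) →
      eLpNorm f 2 volume ≤ ENNReal.ofReal C * eLpNorm (fracDiff s f) 2 volume := by
  obtain ⟨z, D, hdisj, hD⟩ := exists_ball_subset_compl_of_isBounded hΩb
  set β := volume (Metric.ball z 1)
  have hβ : β ≠ 0 := (Metric.measure_ball_pos _ _ one_pos).ne'
  have hβ' : β ≠ ∞ := measure_ball_lt_top.ne
  set M := β⁻¹ * ENNReal.ofReal (D ^ ((n : ℝ) + 2 * s))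
  have hM : M ≠ ∞ := ENNReal.mul_ne_top (ENNReal.inv_ne_top.2 hβ) ENNReal.ofReal_ne_top
  refine ⟨M.toReal + 1, by positivity, fun f hf hfΩ => ?_⟩
  have hres : eLpNorm f 2 volume = eLpNorm f 2 (volume.restrict Ω) := by
    rw [← eLpNorm_indicator_eq_eLpNorm_restrict hΩ]
    refine eLpNorm_congr_ae ?_
    filter_upwards [(ae_restrict_iff' hΩ.compl).1 hfΩ] with x hx
    by_cases hxΩ : x ∈ Ω
    · rw [indicator_of_mem hxΩ]
    · rw [indicator_of_notMem hxΩ, hx hxΩ]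
  have hmul := measure_mul_eLpNorm_sq_le_fracDiff hΩ measurableSet_ball hD hs hf
    (ae_mono (Measure.restrict_mono hdisj le_rfl) hfΩ)
  have hsq : eLpNorm f 2 volume ^ 2 ≤ M * eLpNorm (fracDiff s f) 2 volume ^ 2 := by
    rwa [hres, mul_assoc, ← ENNReal.mul_le_iff_le_inv hβ hβ']
  rw [← ENNReal.pow_le_pow_left_iff two_ne_zero, mul_pow]
  refine hsq.trans ?_
  gcongr
  rw [ENNReal.ofReal_add ENNReal.toReal_nonneg zero_le_one, ENNReal.ofReal_toReal hM,
    ENNReal.ofReal_one, add_sq]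
  simpa [add_assoc, two_mul] using le_self_add.trans le_add_self

/-- The measure `K(x,y) dx dy`. The form `B_K` is the inner product of its `L²` space evaluated at
the difference quotients `fracDiff s f` and `fracDiff s g`. -/
noncomputable def kernelMeasure (K : 𝔼 n → 𝔼 n → ℝ) : Measure (𝔼 n × 𝔼 n) :=
  volume.withDensity fun p => ENNReal.ofReal (K p.1 p.2)

instance : SFinite (kernelMeasure K) := Measure.withDensity.instSFinite

/-- The norm `B_K(f,f)^(1/2)`. -/
noncomputable def energyNorm (s : ℝ) (K : 𝔼 n → 𝔼 n → ℝ) (f : 𝔼 n → ℝ) : ℝ≥0∞ :=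
  eLpNorm (fracDiff s f) 2 (kernelMeasure K)

theorem kernelMeasure_absolutelyContinuous : kernelMeasure K ≪ volume :=
  withDensity_absolutelyContinuous _ _

namespace IsEllipticKernel

theorem kernelMeasure_le (hK : IsEllipticKernel lam Lam K) :
    kernelMeasure K ≤ ENNReal.ofReal Lam • volume := by
  rw [← withDensity_const]
  exact withDensity_mono (.of_forall fun p => ENNReal.ofReal_le_ofReal (hK.upper _ _))

theorem volume_le (hK : IsEllipticKernel lam Lam K) (hlam : 0 < lam) :
    volume ≤ ENNReal.ofReal lam⁻¹ • kernelMeasure K := by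
  rw [kernelMeasure, ← withDensity_smul' _ _ ENNReal.ofReal_ne_top]
  nth_rw 1 [← withDensity_one (μ := (volume : Measure (𝔼 n × 𝔼 n)))]
  refine withDensity_mono (.of_forall fun p => ?_)
  rw [Pi.one_apply, Pi.smul_apply, smul_eq_mul, ← ENNReal.ofReal_mul (inv_pos.2 hlam).le,
    ENNReal.one_le_ofReal, inv_mul_eq_div, one_le_div hlam]
  exact hK.lower _ _

theorem bilinForm_eq (hK : IsEllipticKernel lam Lam K) (hlam : 0 ≤ lam) (f g : 𝔼 n → ℝ) :
    bilinForm s K f g = ∫ p, fracDiff s f p * fracDiff s g p ∂kernelMeasure K := by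
  have hmeas : Measurable fun p : 𝔼 n × 𝔼 n => ENNReal.ofReal (K p.1 p.2) :=
    hK.measurable.ennreal_ofReal
  rw [kernelMeasure, integral_withDensity_eq_integral_toReal_smul hmeas
    (.of_forall fun _ => ENNReal.ofReal_lt_top)]
  refine integral_congr_ae (.of_forall fun p => ?_)
  simp only [fracDiff_mul_fracDiff, smul_eq_mul, mul_div_assoc',
    ENNReal.toReal_ofReal (hlam.trans (hK.lower p.1 p.2))]

theorem memLp (hK : IsEllipticKernel lam Lam K) {H : 𝔼 n × 𝔼 n → ℝ} (hH : MemLp H 2 volume) :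
    MemLp H 2 (kernelMeasure K) :=
  hH.of_measure_le_smul ENNReal.ofReal_ne_top hK.kernelMeasure_le

theorem memL2L2 (hK : IsEllipticKernel lam Lam K) {T : ℝ} {H : ℝ → 𝔼 n × 𝔼 n → ℝ}
    (hH : MemL2L2 T volume H) : MemL2L2 T (kernelMeasure K) H := by
  refine hH.of_measure_le_smul (c := ENNReal.ofReal Lam) ENNReal.ofReal_ne_top ?_
  rw [← Measure.prod_smul_right]
  exact Measure.prod_mono le_rfl hK.kernelMeasure_le

theorem energyNorm_le (hK : IsEllipticKernel lam Lam K) (hLam : 0 ≤ Lam) (f : 𝔼 n → ℝ) :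
    energyNorm s K f ≤ ENNReal.ofReal √Lam * hsNorm s f :=
  (eLpNorm_two_le_of_measure_le_smul hLam hK.kernelMeasure_le _).trans
    (mul_le_mul_right (eLpNorm_fracDiff_le_hsNorm s f) _)

theorem hsNorm_le (hK : IsEllipticKernel lam Lam K) (hlam : 0 < lam) {C : ℝ}
    (hf : eLpNorm f 2 volume ≤ ENNReal.ofReal C * eLpNorm (fracDiff s f) 2 volume) (hC : 0 ≤ C) :
    hsNorm s f ≤ ENNReal.ofReal ((C + 1) * √lam⁻¹) * energyNorm s K f := by
  have hfrac : eLpNorm (fracDiff s f) 2 volume ≤ ENNReal.ofReal √lam⁻¹ * energyNorm s K f :=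
    eLpNorm_two_le_of_measure_le_smul (inv_pos.2 hlam).le (hK.volume_le hlam) _
  calc hsNorm s f ≤ eLpNorm f 2 volume + eLpNorm (fracDiff s f) 2 volume := hsNorm_le_add s f
    _ ≤ ENNReal.ofReal (C + 1) * eLpNorm (fracDiff s f) 2 volume := by
        rw [ENNReal.ofReal_add hC zero_le_one, ENNReal.ofReal_one, add_mul, one_mul]
        gcongr
    _ ≤ ENNReal.ofReal (C + 1) * (ENNReal.ofReal √lam⁻¹ * energyNorm s K f) := by gcongr
    _ = ENNReal.ofReal ((C + 1) * √lam⁻¹) * energyNorm s K f := by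
        rw [ENNReal.ofReal_mul (by positivity), mul_assoc]

end IsEllipticKernel

theorem exists_hsNorm_le_energyNorm [Nonempty (Fin n)] (hs : 0 ≤ (n : ℝ) + 2 * s) {Ω : Set (𝔼 n)}
    (hΩb : Bornology.IsBounded Ω) (hΩ : MeasurableSet Ω) (hlam : 0 < lam) :
    ∃ P : ℝ, 0 < P ∧ ∀ K : 𝔼 n → 𝔼 n → ℝ, IsEllipticKernel lam Lam K →
      ∀ f, MemHsTilde Ω s f → hsNorm s f ≤ ENNReal.ofReal P * energyNorm s K f := by
  obtain ⟨C, hC, hpoincare⟩ := exists_eLpNorm_le_fracDiff hs hΩb hΩ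
  exact ⟨(C + 1) * √lam⁻¹, by positivity, fun K hK f hf =>
    hK.hsNorm_le hlam (hpoincare f hf.1.1.1 (hf.ae_eq_zero hΩ)) hC.le⟩

end Coercivity

section EnergyNorm

variable {n : ℕ} {s T r lam Lam : ℝ} {K : 𝔼 n → 𝔼 n → ℝ} {f g h : 𝔼 n → ℝ} {v w : ℝ → 𝔼 n → ℝ}

theorem energyNorm_congr_ae (h : f =ᵐ[volume] g) : energyNorm s K f = energyNorm s K g :=
  eLpNorm_congr_ae (kernelMeasure_absolutelyContinuous.ae_le (fracDiff_congr_ae h))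

theorem bilinForm_comm (f g : 𝔼 n → ℝ) : bilinForm s K f g = bilinForm s K g f := by
  simp only [bilinForm, mul_comm (f _ - f _)]

theorem bilinForm_const_mul_right (c : ℝ) (f g : 𝔼 n → ℝ) :
    bilinForm s K f (fun x => c * g x) = c * bilinForm s K f g := by
  rw [bilinForm, bilinForm, ← integral_const_mul]
  congr 1 with p
  ring

theorem fracDiff_timeIntegral_ae_kernelMeasure
    (hw : MemL2L2 r (sobolevMeasure n) fun t => sobolevGraph s (w t)) :
    fracDiff s (timeIntegral w r) =ᵐ[kernelMeasure K] timeIntegral (fun t => fracDiff s (w t)) r :=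
  kernelMeasure_absolutelyContinuous.ae_le (fracDiff_timeIntegral hw.of_sobolevGraph)

namespace IsEllipticKernel

theorem upper_nonneg (hK : IsEllipticKernel lam Lam K) (hlam : 0 ≤ lam) : 0 ≤ Lam :=
  hlam.trans ((hK.lower 0 0).trans (hK.upper 0 0))

theorem energyNorm_lt_top (hK : IsEllipticKernel lam Lam K) (hf : MemHs s f) :
    energyNorm s K f < ∞ :=
  (hK.memLp hf.memLp_fracDiff).2

theorem energyNorm_sub_le (hK : IsEllipticKernel lam Lam K) (hf : MemHs s f) (hg : MemHs s g) :
    energyNorm s K (fun x => f x - g x) ≤ energyNorm s K f + energyNorm s K g := by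
  rw [energyNorm, fracDiff_sub]
  exact eLpNorm_sub_le (hK.memLp hf.memLp_fracDiff).1 (hK.memLp hg.memLp_fracDiff).1 one_le_two

theorem toReal_energyNorm_le (hK : IsEllipticKernel lam Lam K) (hLam : 0 ≤ Lam) (hf : MemHs s f) :
    (energyNorm s K f).toReal ≤ √Lam * (hsNorm s f).toReal := by
  have h := ENNReal.toReal_mono (ENNReal.mul_ne_top ENNReal.ofReal_ne_top hf.hsNorm_lt_top.ne)
    (hK.energyNorm_le hLam f)
  rwa [ENNReal.toReal_mul, ENNReal.toReal_ofReal (Real.sqrt_nonneg Lam)] at h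

theorem abs_bilinForm_le (hK : IsEllipticKernel lam Lam K) (hlam : 0 ≤ lam) (hf : MemHs s f)
    (hg : MemHs s g) :
    |bilinForm s K f g| ≤ (energyNorm s K f).toReal * (energyNorm s K g).toReal := by
  rw [hK.bilinForm_eq hlam]
  exact abs_integral_mul_le (hK.memLp hf.memLp_fracDiff) (hK.memLp hg.memLp_fracDiff)

theorem bilinForm_sub_right (hK : IsEllipticKernel lam Lam K) (hlam : 0 ≤ lam) (hf : MemHs s f)
    (hg : MemHs s g) (hh : MemHs s h) :
    bilinForm s K f (fun x => g x - h x) = bilinForm s K f g - bilinForm s K f h := by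
  simp only [hK.bilinForm_eq hlam, fracDiff_sub, mul_comm (fracDiff s f _)]
  exact integral_sub_mul_of_memLp_two (hK.memLp hg.memLp_fracDiff) (hK.memLp hh.memLp_fracDiff)
    (hK.memLp hf.memLp_fracDiff)

theorem integrableOn_bilinForm (hK : IsEllipticKernel lam Lam K) (hlam : 0 ≤ lam)
    (hw : MemL2L2 r (sobolevMeasure n) fun t => sobolevGraph s (w t)) (hf : MemHs s f) :
    IntegrableOn (fun t => bilinForm s K (w t) f) (Ioo 0 r) := by
  simp only [hK.bilinForm_eq hlam]
  exact integrable_integral_mul (hK.memL2L2 hw.fracDiff_of_sobolevGraph)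
    (memLp_uncurry_const (hK.memLp hf.memLp_fracDiff))

theorem bilinForm_timeIntegral_eq (hK : IsEllipticKernel lam Lam K) (hlam : 0 ≤ lam)
    (hw : MemL2L2 r (sobolevMeasure n) fun t => sobolevGraph s (w t)) (f : 𝔼 n → ℝ) :
    bilinForm s K (timeIntegral w r) f =
      ∫ p, timeIntegral (fun t => fracDiff s (w t)) r p * fracDiff s f p ∂kernelMeasure K := by
  rw [hK.bilinForm_eq hlam]
  refine integral_congr_ae ?_
  filter_upwards [fracDiff_timeIntegral_ae_kernelMeasure hw] with p hp
  rw [hp]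

theorem bilinForm_timeIntegral (hK : IsEllipticKernel lam Lam K) (hlam : 0 ≤ lam)
    (hw : MemL2L2 r (sobolevMeasure n) fun t => sobolevGraph s (w t)) (hf : MemHs s f) :
    bilinForm s K (timeIntegral w r) f = ∫ t in Ioo 0 r, bilinForm s K (w t) f := by
  simp only [hK.bilinForm_timeIntegral_eq hlam hw, hK.bilinForm_eq hlam]
  exact integral_timeIntegral_mul (hK.memL2L2 hw.fracDiff_of_sobolevGraph)
    (hK.memLp hf.memLp_fracDiff)

theorem bilinForm_timeIntegral_sub (hK : IsEllipticKernel lam Lam K) (hlam : 0 ≤ lam)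
    (hv : MemL2L2 r (sobolevMeasure n) fun t => sobolevGraph s (v t))
    (hw : MemL2L2 r (sobolevMeasure n) fun t => sobolevGraph s (w t)) (hf : MemHs s f) :
    bilinForm s K (timeIntegral (fun t x => v t x - w t x) r) f =
      bilinForm s K (timeIntegral v r) f - bilinForm s K (timeIntegral w r) f := by
  rw [hK.bilinForm_timeIntegral hlam (hv.sobolevGraph_sub hw) hf,
    hK.bilinForm_timeIntegral hlam hv hf, hK.bilinForm_timeIntegral hlam hw hf,
    ← integral_sub (hK.integrableOn_bilinForm hlam hv hf) (hK.integrableOn_bilinForm hlam hw hf)]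
  refine integral_congr_ae ?_
  filter_upwards [hv.ae_memLp, hw.ae_memLp] with t hvt hwt
  simp only [bilinForm_comm _ f]
  exact hK.bilinForm_sub_right hlam hf (memHs_iff_memLp.2 hvt) (memHs_iff_memLp.2 hwt)

theorem integrableOn_bilinForm_timeIntegral (hK : IsEllipticKernel lam Lam K) (hlam : 0 ≤ lam)
    (hv : MemL2L2 r (sobolevMeasure n) fun t => sobolevGraph s (v t))
    (hw : MemL2L2 r (sobolevMeasure n) fun t => sobolevGraph s (w t)) :
    IntegrableOn (fun t => bilinForm s K (timeIntegral v t) (w t)) (Ioo 0 r) := by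
  have hint := integrable_integral_mul (hK.memL2L2 hv.fracDiff_of_sobolevGraph).timeIntegral
    (hK.memL2L2 hw.fracDiff_of_sobolevGraph)
  refine IntegrableOn.congr_fun hint (fun t ht => ?_) measurableSet_Ioo
  exact (hK.bilinForm_timeIntegral_eq hlam (hv.mono ht.2.le) (w t)).symm

theorem integral_bilinForm_timeIntegral_self (hK : IsEllipticKernel lam Lam K) (hlam : 0 ≤ lam)
    (hr : 0 ≤ r) (hw : MemL2L2 r (sobolevMeasure n) fun t => sobolevGraph s (w t)) :
    ∫ t in Ioo 0 r, bilinForm s K (timeIntegral w t) (w t) =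
      2⁻¹ * (energyNorm s K (timeIntegral w r)).toReal ^ 2 := by
  rw [energyNorm, eLpNorm_congr_ae (fracDiff_timeIntegral_ae_kernelMeasure hw),
    ← integral_timeIntegral_mul_self hr (hK.memL2L2 hw.fracDiff_of_sobolevGraph)]
  exact setIntegral_congr_fun measurableSet_Ioo fun t ht =>
    hK.bilinForm_timeIntegral_eq hlam (hw.mono ht.2.le) (w t)

theorem energyNorm_timeIntegral_le (hK : IsEllipticKernel lam Lam K) (hr : r ≤ T)
    (hw : MemL2L2 T (sobolevMeasure n) fun t => sobolevGraph s (w t)) :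
    energyNorm s K (timeIntegral w r) ≤ ∫⁻ t in Ioo 0 T, energyNorm s K (w t) := by
  rw [energyNorm, eLpNorm_congr_ae (fracDiff_timeIntegral_ae_kernelMeasure (hw.mono hr))]
  exact eLpNorm_timeIntegral_le hr (hK.memL2L2 hw.fracDiff_of_sobolevGraph)

theorem lintegral_energyNorm_lt_top (hK : IsEllipticKernel lam Lam K)
    (hw : MemL2L2 T (sobolevMeasure n) fun t => sobolevGraph s (w t)) :
    ∫⁻ t in Ioo 0 T, energyNorm s K (w t) < ∞ :=
  lintegral_eLpNorm_two_lt_top (hK.memL2L2 hw.fracDiff_of_sobolevGraph)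

end IsEllipticKernel

end EnergyNorm

section PorousPhi

variable {m : ℝ}

theorem porousPhi_neg (m r : ℝ) : porousPhi m (-r) = -porousPhi m r := by
  simp [porousPhi]

theorem porousPhi_of_nonneg (hm : m ≠ 0) {r : ℝ} (hr : 0 ≤ r) : porousPhi m r = r ^ m := by
  rcases hr.eq_or_lt with rfl | hr
  · simp [porousPhi, Real.zero_rpow hm]
  · rw [porousPhi, abs_of_pos hr, Real.rpow_sub_one hr.ne', div_mul_cancel₀ _ hr.ne']

theorem measurable_porousPhi (m : ℝ) : Measurable (porousPhi m) :=
  (measurable_norm.pow_const _).mul measurable_id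

theorem strictMono_porousPhi (hm : 0 < m) : StrictMono (porousPhi m) :=
  strictMono_of_odd_strictMonoOn_nonneg (porousPhi_neg m) <|
    (Real.strictMonoOn_rpow_Ici_of_exponent_pos hm).congr
      fun _ hr => (porousPhi_of_nonneg hm.ne' hr).symm

theorem sub_mul_porousPhi_sub_nonneg (hm : 0 < m) (a b : ℝ) :
    0 ≤ (a - b) * (porousPhi m a - porousPhi m b) := by
  have hmono := (strictMono_porousPhi hm).monotone
  rcases le_total a b with h | h
  · exact mul_nonneg_of_nonpos_of_nonpos (sub_nonpos.2 h) (sub_nonpos.2 (hmono h))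
  · exact mul_nonneg (sub_nonneg.2 h) (sub_nonneg.2 (hmono h))

theorem porousPhi_inv_porousPhi (hm : m ≠ 0) (r : ℝ) : porousPhi m⁻¹ (porousPhi m r) = r := by
  have of_nonneg : ∀ r, 0 ≤ r → porousPhi m⁻¹ (porousPhi m r) = r := fun r hr => by
    rw [porousPhi_of_nonneg hm hr, porousPhi_of_nonneg (inv_ne_zero hm) (Real.rpow_nonneg hr m),
      Real.rpow_rpow_inv hr hm]
  rcases le_total 0 r with hr | hr
  · exact of_nonneg r hr
  · simpa only [porousPhi_neg, neg_inj] using of_nonneg (-r) (neg_nonneg.2 hr)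

theorem abs_le_one_add_abs_porousPhi (hm : 1 ≤ m) (r : ℝ) : |r| ≤ 1 + |porousPhi m r| := by
  rcases le_total |r| 1 with h | h
  · linarith [abs_nonneg (porousPhi m r)]
  · have hpow : 1 ≤ |r| ^ (m - 1) := Real.one_le_rpow h (sub_nonneg.2 hm)
    rw [porousPhi, abs_mul, abs_of_nonneg (Real.rpow_nonneg (abs_nonneg r) (m - 1))]
    nlinarith

variable {P : Type*} [MeasurableSpace P] {μ : Measure P} {f : P → ℝ}

theorem aestronglyMeasurable_of_porousPhi (hm : m ≠ 0)
    (hf : AEStronglyMeasurable (fun p => porousPhi m (f p)) μ) : AEStronglyMeasurable f μ := by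
  have h := (measurable_porousPhi m⁻¹).comp_aemeasurable hf.aemeasurable
  exact (h.congr (.of_forall fun p => porousPhi_inv_porousPhi hm (f p))).aestronglyMeasurable

theorem memLp_of_porousPhi [IsFiniteMeasure μ] {p : ℝ≥0∞} (hm : 1 ≤ m)
    (hf : MemLp (fun x => porousPhi m (f x)) p μ) : MemLp f p μ :=
  ((memLp_const (1 : ℝ)).add hf.abs).mono
    (aestronglyMeasurable_of_porousPhi (zero_lt_one.trans_le hm).ne' hf.1)
    (.of_forall fun x => (abs_le_one_add_abs_porousPhi hm (f x)).trans (le_abs_self _))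

end PorousPhi

section WeakFormDensity

variable {n : ℕ} {s lam Lam : ℝ} {Ω : Set (𝔼 n)} {K : 𝔼 n → 𝔼 n → ℝ} {a U f : 𝔼 n → ℝ}

/-- The function on `ℝⁿ ⊕ (ℝⁿ × ℝⁿ)` whose `L²` inner product with `sobolevGraph s f` is
`∫_Ω a f + B_K(U, f)`. -/
noncomputable def weakFormDensity (Ω : Set (𝔼 n)) (s : ℝ) (K : 𝔼 n → 𝔼 n → ℝ) (a U : 𝔼 n → ℝ) :
    𝔼 n ⊕ (𝔼 n × 𝔼 n) → ℝ :=
  Sum.elim (Ω.indicator a) fun p => K p.1 p.2 * fracDiff s U p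

theorem memLp_weakFormDensity (hΩ : MeasurableSet Ω) (hK : IsEllipticKernel lam Lam K)
    (ha : MemLp a 2 (volume.restrict Ω)) (hU : MemHs s U) :
    MemLp (weakFormDensity Ω s K a U) 2 (sobolevMeasure n) := by
  refine memLp_two_disjointSum_iff.2 ⟨(memLp_indicator_iff_restrict hΩ).2 ha, ?_⟩
  refine hU.memLp_fracDiff.of_le_mul (c := max |lam| |Lam|)
    (hK.measurable.aestronglyMeasurable.mul hU.memLp_fracDiff.1) (.of_forall fun p => ?_)
  change ‖K p.1 p.2 * fracDiff s U p‖ ≤ _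
  rw [norm_mul]
  gcongr
  exact abs_le_max_abs_abs (hK.lower _ _) (hK.upper _ _)

theorem integral_weakFormDensity_mul_sobolevGraph (hΩ : MeasurableSet Ω)
    (hK : IsEllipticKernel lam Lam K) (ha : MemLp a 2 (volume.restrict Ω)) (hU : MemHs s U)
    (hf : MemHs s f) :
    ∫ z, weakFormDensity Ω s K a U z * sobolevGraph s f z ∂sobolevMeasure n =
      (∫ x in Ω, a x * f x) + bilinForm s K U f := by
  have hint := (memLp_weakFormDensity hΩ hK ha hU).integrable_mul (memHs_iff_memLp.1 hf)
  have hindicator : ∀ x, Ω.indicator a x * f x = Ω.indicator (fun x => a x * f x) x := fun x => by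
    by_cases hx : x ∈ Ω <;> simp [hx]
  refine (integral_disjointSum hint).trans ?_
  simp only [Pi.mul_apply, weakFormDensity, sobolevGraph, Sum.elim_inl, Sum.elim_inr, bilinForm,
    hindicator, integral_indicator hΩ, mul_assoc, fracDiff_mul_fracDiff, mul_div_assoc]

theorem ae_forall_memHsTilde_integral_add_bilinForm_eq_zero {R : Type*} [MeasurableSpace R]
    {ρ : Measure R} {a U : R → 𝔼 n → ℝ} (hΩ : MeasurableSet Ω) (hK : IsEllipticKernel lam Lam K)
    (ha : ∀ᵐ t ∂ρ, MemLp (a t) 2 (volume.restrict Ω)) (hU : ∀ᵐ t ∂ρ, MemHs s (U t))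
    (htest : ∀ ψ, IsSpaceTestFunction Ω ψ → MemHs s ψ →
      ∀ᵐ t ∂ρ, (∫ x in Ω, a t x * ψ x) + bilinForm s K (U t) ψ = 0) :
    ∀ᵐ t ∂ρ, ∀ f, MemHsTilde Ω s f → (∫ x in Ω, a t x * f x) + bilinForm s K (U t) f = 0 := by
  have hdens := ae_forall_memHsTilde_integral_eq_zero (Ω := Ω) (s := s) (ρ := ρ)
    (q := fun t => weakFormDensity Ω s K (a t) (U t)) ?_ fun ψ hψ hψs => ?_
  · filter_upwards [hdens, ha, hU] with t ht hat hUt f hf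
    rw [← integral_weakFormDensity_mul_sobolevGraph hΩ hK hat hUt hf.1, ht f hf]
  · filter_upwards [ha, hU] with t hat hUt using memLp_weakFormDensity hΩ hK hat hUt
  · filter_upwards [htest ψ hψ hψs, ha, hU] with t ht hat hUt
    rw [integral_weakFormDensity_mul_sobolevGraph hΩ hK hat hUt hψs, ht]

end WeakFormDensity

section WeakSolution

variable {n : ℕ} {s T m lam Lam : ℝ} {Ω : Set (𝔼 n)} {K : 𝔼 n → 𝔼 n → ℝ} {f ψ : 𝔼 n → ℝ}

theorem IsSpaceTestFunction.isTestFunction_mul (hψ : IsSpaceTestFunction Ω ψ) {η : ℝ → ℝ}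
    (hη : ContDiff ℝ (⊤ : ℕ∞) η) (hηc : HasCompactSupport η) (hηT : tsupport η ⊆ Iio T) :
    IsTestFunction Ω T fun t x => η t * ψ x := by
  have hsub : tsupport (Function.uncurry fun t x => η t * ψ x) ⊆ tsupport η ×ˢ tsupport ψ :=
    closure_minimal (fun z hz => ⟨subset_tsupport _ (left_ne_zero_of_mul hz),
      subset_tsupport _ (right_ne_zero_of_mul hz)⟩)
      ((isClosed_tsupport η).prod (isClosed_tsupport ψ))
  exact
    { contDiff := (hη.comp contDiff_fst).mul (hψ.contDiff.comp contDiff_snd)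
      hasCompactSupport := (hηc.isCompact.prod hψ.hasCompactSupport.isCompact).of_isClosed_subset
        (isClosed_tsupport _) hsub
      tsupport_subset := hsub.trans (prod_mono hηT hψ.tsupport_subset) }

variable {u₀ : 𝔼 n → ℝ} {φ u : ℝ → 𝔼 n → ℝ}

theorem IsWeakSolution.memL2L2 (hu : IsWeakSolution Ω T s m K u₀ φ u) (hm : 1 ≤ m)
    (hΩb : Bornology.IsBounded Ω) : MemL2L2 T (volume.restrict Ω) u := by
  have : IsFiniteMeasure (volume.restrict Ω) := isFiniteMeasure_restrict.2 hΩb.measure_lt_top.ne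
  exact memLp_of_porousPhi hm (hu.memL2Hs.memL2L2_sobolevGraph.of_sobolevGraph.mono_measure
    (Measure.prod_mono le_rfl Measure.restrict_le_self))

theorem IsWeakSolution.weak_form_mul (hu : IsWeakSolution Ω T s m K u₀ φ u)
    (huΩ : MemL2L2 T (volume.restrict Ω) u) (hψ : IsSpaceTestFunction Ω ψ) (hψs : MemHs s ψ)
    {η : ℝ → ℝ} (hη : ContDiff ℝ (⊤ : ℕ∞) η) (hηc : HasCompactSupport η)
    (hηT : tsupport η ⊆ Iio T) :
    -(∫ t in Ioo 0 T, (∫ x in Ω, u t x * ψ x) * deriv η t) +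
        ∫ t in Ioo 0 T, η t * bilinForm s K (fun x => porousPhi m (u t x)) ψ =
      (∫ x in Ω, u₀ x * ψ x) * η 0 := by
  have hη' : Continuous (deriv η) := hη.continuous_deriv (by exact_mod_cast le_top)
  obtain ⟨M, hM⟩ := hη'.bounded_above_of_compact_support hηc.deriv
  have hint : Integrable (fun z : ℝ × 𝔼 n => u z.1 z.2 * ψ z.2 * deriv η z.1)
      ((volume.restrict (Ioo 0 T)).prod (volume.restrict Ω)) :=
    (huΩ.integrable_mul (memLp_uncurry_const (hψs.1.restrict Ω))).mul_bdd
      (hη'.comp continuous_fst).aestronglyMeasurable (.of_forall fun z => hM z.1)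
  have htime : ∫ p in Ioo 0 T ×ˢ Ω, u p.1 p.2 * deriv (fun τ => η τ * ψ p.2) p.1 =
      ∫ t in Ioo 0 T, (∫ x in Ω, u t x * ψ x) * deriv η t := by
    simp_rw [← integral_mul_const]
    rw [Measure.volume_eq_prod, ← Measure.prod_restrict, ← integral_prod _ hint]
    congr 1 with z
    simp only [deriv_mul_const_field]
    ring
  have hinitial : ∫ x in Ω, u₀ x * (η 0 * ψ x) = (∫ x in Ω, u₀ x * ψ x) * η 0 := by
    rw [← integral_mul_const]
    congr 1 with x
    ring
  have hw := hu.weak_form _ (hψ.isTestFunction_mul hη hηc hηT)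
  simp only [bilinForm_const_mul_right, htime, hinitial] at hw
  exact hw

theorem IsWeakSolution.ae_integral_add_bilinForm_eq (hu : IsWeakSolution Ω T s m K u₀ φ u)
    (huΩ : MemL2L2 T (volume.restrict Ω) u) (hT : 0 < T) (hK : IsEllipticKernel lam Lam K)
    (hlam : 0 ≤ lam) (hψ : IsSpaceTestFunction Ω ψ) (hψs : MemHs s ψ) :
    ∀ᵐ t ∂volume.restrict (Ioo 0 T),
      (∫ x in Ω, u t x * ψ x) + bilinForm s K (timePrimitive m u t) ψ = ∫ x in Ω, u₀ x * ψ x := by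
  have hΦ := hu.memL2Hs.memL2L2_sobolevGraph
  have hmass : IntegrableOn (fun t => ∫ x in Ω, u t x * ψ x) (Ioo 0 T) :=
    integrable_integral_mul huΩ (memLp_uncurry_const (hψs.1.restrict Ω))
  filter_upwards [ae_add_integral_eq_of_weak_deriv hT hmass (hK.integrableOn_bilinForm hlam hΦ hψs)
      fun η hη hηc hηT => hu.weak_form_mul huΩ hψ hψs hη hηc hηT,
    ae_restrict_mem measurableSet_Ioo] with t ht htT
  rwa [← hK.bilinForm_timeIntegral hlam (hΦ.mono htT.2.le) hψs] at ht

theorem IsWeakSolution.ae_forall_integral_add_bilinForm_eq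
    (hu : IsWeakSolution Ω T s m K u₀ φ u) (huΩ : MemL2L2 T (volume.restrict Ω) u) (hT : 0 < T)
    (hΩ : MeasurableSet Ω) (hK : IsEllipticKernel lam Lam K) (hlam : 0 ≤ lam)
    (hu₀ : MemLp u₀ 2 (volume.restrict Ω)) :
    ∀ᵐ t ∂volume.restrict (Ioo 0 T), ∀ f, MemHsTilde Ω s f →
      (∫ x in Ω, u t x * f x) + bilinForm s K (timePrimitive m u t) f = ∫ x in Ω, u₀ x * f x := by
  have hprimitive : ∀ᵐ t ∂volume.restrict (Ioo 0 T), MemHs s (timePrimitive m u t) := by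
    filter_upwards [ae_restrict_mem measurableSet_Ioo] with t ht
    exact memHs_timeIntegral (hu.memL2Hs.memL2L2_sobolevGraph.mono ht.2.le)
  have hzero := ae_forall_memHsTilde_integral_add_bilinForm_eq_zero
    (a := fun t x => u t x - u₀ x) hΩ hK
    (huΩ.ae_memLp.mono fun t ht => ht.sub hu₀) hprimitive fun ψ hψ hψs => ?_
  · filter_upwards [hzero, huΩ.ae_memLp] with t ht hut f hf
    have h := ht f hf
    rw [integral_sub_mul_of_memLp_two hut hu₀ (hf.1.1.restrict Ω)] at h
    linarith
  · filter_upwards [hu.ae_integral_add_bilinForm_eq huΩ hT hK hlam hψ hψs, huΩ.ae_memLp]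
      with t ht hut
    rw [integral_sub_mul_of_memLp_two hut hu₀ (hψs.1.restrict Ω)]
    linarith

end WeakSolution

section DualNorm

variable {n : ℕ} {s : ℝ} {Ω : Set (𝔼 n)} {w f : 𝔼 n → ℝ}

theorem hsNorm_const_mul (c : ℝ) (f : 𝔼 n → ℝ) :
    hsNorm s (fun x => c * f x) = ‖c‖ₑ * hsNorm s f := by
  rw [hsNorm_eq_eLpNorm, sobolevGraph_const_mul, hsNorm_eq_eLpNorm]
  exact eLpNorm_const_smul c _ 2 _

theorem MemHs.ae_eq_zero_of_hsNorm_eq_zero (hf : MemHs s f) (h : hsNorm s f = 0) :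
    f =ᵐ[volume] 0 :=
  (eLpNorm_eq_zero_iff hf.1.1 two_ne_zero).1
    (le_antisymm ((eLpNorm_le_hsNorm s f).trans h.le) zero_le)

theorem hNegNorm_le (hw : MemLp w 2 (volume.restrict Ω)) {M : ℝ≥0∞}
    (h : ∀ f, MemHsTilde Ω s f → hsNorm s f ≤ 1 → ENNReal.ofReal |∫ x in Ω, w x * f x| ≤ M) :
    hNegNorm Ω s w ≤ M := by
  refine iSup_le fun f => iSup₂_le fun hf hf1 => ?_
  have hint : IntegrableOn (fun x => w x * f x) Ω := hw.integrable_mul (hf.1.1.restrict Ω)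
  rw [if_pos hint]
  exact h f hf hf1

theorem ofReal_abs_integral_le_hNegNorm (hw : MemLp w 2 (volume.restrict Ω))
    (hf : MemHsTilde Ω s f) (hf1 : hsNorm s f ≤ 1) :
    ENNReal.ofReal |∫ x in Ω, w x * f x| ≤ hNegNorm Ω s w := by
  refine le_iSup₂_of_le f hf (le_iSup_of_le hf1 ?_)
  have hint : IntegrableOn (fun x => w x * f x) Ω := hw.integrable_mul (hf.1.1.restrict Ω)
  rw [if_pos hint]

theorem hNegNorm_lt_top (hw : MemLp w 2 (volume.restrict Ω)) : hNegNorm Ω s w < ∞ := by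
  refine (hNegNorm_le hw fun f hf hf1 => ENNReal.ofReal_le_ofReal ?_).trans_lt
    (ENNReal.ofReal_lt_top (r := (eLpNorm w 2 (volume.restrict Ω)).toReal))
  refine (abs_integral_mul_le hw (hf.1.1.restrict Ω)).trans
    (mul_le_of_le_one_right ENNReal.toReal_nonneg (ENNReal.toReal_le_of_le_ofReal zero_le_one ?_))
  rw [ENNReal.ofReal_one]
  exact (eLpNorm_restrict_le f 2 volume Ω).trans ((eLpNorm_le_hsNorm s f).trans hf1)

theorem abs_integral_le_hNegNorm_mul_hsNorm (hw : MemLp w 2 (volume.restrict Ω))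
    (hf : MemHsTilde Ω s f) :
    |∫ x in Ω, w x * f x| ≤ (hNegNorm Ω s w).toReal * (hsNorm s f).toReal := by
  have hfin := hf.1.hsNorm_lt_top.ne
  rcases eq_or_ne (hsNorm s f) 0 with h0 | h0
  · have hzero : ∫ x in Ω, w x * f x = 0 := integral_eq_zero_of_ae <|
      (ae_restrict_of_ae (hf.1.ae_eq_zero_of_hsNorm_eq_zero h0)).mono fun x hx => by simp [hx]
    simp [hzero, h0]
  set a := (hsNorm s f).toReal
  have ha : 0 < a := ENNReal.toReal_pos h0 hfin
  have hnormalized : hsNorm s (fun x => a⁻¹ * f x) ≤ 1 := by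
    rw [hsNorm_const_mul, enorm_inv ha.ne', Real.enorm_of_nonneg ha.le, ENNReal.ofReal_toReal hfin,
      ENNReal.inv_mul_cancel h0 hfin]
  have h := (ENNReal.ofReal_le_iff_le_toReal (hNegNorm_lt_top hw).ne).1
    (ofReal_abs_integral_le_hNegNorm hw (hf.const_mul a⁻¹) hnormalized)
  simp only [mul_left_comm _ a⁻¹, integral_const_mul, abs_mul, abs_of_pos (inv_pos.2 ha)] at h
  rwa [inv_mul_le_iff₀ ha, mul_comm] at h

end DualNorm

section Stability

theorem le_three_mul_of_forall_sq_le {ι : Type*} {a : ι → ℝ} {Z : ℝ} (hZ : 0 ≤ Z)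
    (ha : ∀ i, 0 ≤ a i) (hbdd : BddAbove (range a))
    (h : ∀ S, (∀ i, a i ≤ S) → ∀ i, a i ^ 2 ≤ 2 * (S * Z + Z ^ 2)) (i : ι) : a i ≤ 3 * Z := by
  have : Nonempty ι := ⟨i⟩
  set S := ⨆ i, a i
  have hle : ∀ i, a i ≤ S := le_ciSup hbdd
  have hS : 0 ≤ S := (ha i).trans (hle i)
  have hsq : S ≤ √(2 * (S * Z + Z ^ 2)) := ciSup_le fun j => Real.le_sqrt_of_sq_le (h S hle j)
  rw [Real.le_sqrt hS (by positivity)] at hsq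
  nlinarith [hle i]

variable {n : ℕ} {s T r P lam Lam : ℝ} {Ω : Set (𝔼 n)} {K : 𝔼 n → 𝔼 n → ℝ}
  {w₀ : 𝔼 n → ℝ} {g V w : ℝ → 𝔼 n → ℝ}

theorem MemL2L2.l1HsNorm_lt_top (hw : MemL2L2 T (sobolevMeasure n) fun t => sobolevGraph s (w t)) :
    l1HsNorm T s w < ∞ := by
  simpa only [l1HsNorm, hsNorm_eq_eLpNorm] using lintegral_eLpNorm_two_lt_top hw

theorem MemL2L2.integrableOn_toReal_hsNorm
    (hw : MemL2L2 T (sobolevMeasure n) fun t => sobolevGraph s (w t)) :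
    IntegrableOn (fun t => (hsNorm s (w t)).toReal) (Ioo 0 T) := by
  refine integrable_toReal_of_lintegral_ne_top ?_ hw.l1HsNorm_lt_top.ne
  simpa only [hsNorm_eq_eLpNorm] using aemeasurable_eLpNorm_two hw.1

theorem MemL2L2.integral_toReal_hsNorm
    (hw : MemL2L2 T (sobolevMeasure n) fun t => sobolevGraph s (w t)) :
    ∫ t in Ioo 0 T, (hsNorm s (w t)).toReal = (l1HsNorm T s w).toReal := by
  have hmeas : AEMeasurable (fun t => hsNorm s (w t)) (volume.restrict (Ioo 0 T)) := by
    simpa only [hsNorm_eq_eLpNorm] using aemeasurable_eLpNorm_two hw.1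
  exact integral_toReal hmeas (ae_lt_top' hmeas hw.l1HsNorm_lt_top.ne)

/-- The relations satisfied by the difference `w` of two weak solutions, where `V`, `g` and `w₀` are
the differences of the functions `Φ^m(u)`, of the functions `Φ^m(φ)` and of the initial data. The
equation is integrated in time, and the monotonicity of `Φ^m` enters only through the sign of
`∫_Ω w (V - g)`. -/
structure IsIntegratedSolution (Ω : Set (𝔼 n)) (T s : ℝ) (K : 𝔼 n → 𝔼 n → ℝ) (w₀ : 𝔼 n → ℝ)
    (g V w : ℝ → 𝔼 n → ℝ) : Prop where
  memL2L2_flux : MemL2L2 T (sobolevMeasure n) fun t => sobolevGraph s (V t)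
  memL2L2_exterior : MemL2L2 T (sobolevMeasure n) fun t => sobolevGraph s (g t)
  memL2L2 : MemL2L2 T (volume.restrict Ω) w
  memLp_initial : MemLp w₀ 2 (volume.restrict Ω)
  memHsTilde : ∀ᵐ t ∂volume.restrict (Ioo 0 T), MemHsTilde Ω s fun x => V t x - g t x
  integral_mul_nonneg : ∀ᵐ t ∂volume.restrict (Ioo 0 T), 0 ≤ ∫ x in Ω, w t x * (V t x - g t x)
  equation : ∀ᵐ t ∂volume.restrict (Ioo 0 T), ∀ f, MemHsTilde Ω s f →
    (∫ x in Ω, w t x * f x) + bilinForm s K (timeIntegral V t) f = ∫ x in Ω, w₀ x * f x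

namespace IsIntegratedSolution

theorem memL2L2_sub (h : IsIntegratedSolution Ω T s K w₀ g V w) :
    MemL2L2 T (sobolevMeasure n) fun t => sobolevGraph s (fun x => V t x - g t x) :=
  h.memL2L2_flux.sobolevGraph_sub h.memL2L2_exterior

theorem memHsTilde_timeIntegral (h : IsIntegratedSolution Ω T s K w₀ g V w) (hr : r ≤ T) :
    MemHsTilde Ω s (timeIntegral (fun t x => V t x - g t x) r) :=
  .timeIntegral (h.memL2L2_sub.mono hr)
    (ae_restrict_of_ae_restrict_of_subset (Ioo_subset_Ioo_right hr) h.memHsTilde)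

theorem memHs_timeIntegral_flux (h : IsIntegratedSolution Ω T s K w₀ g V w) (hr : r ≤ T) :
    MemHs s (timeIntegral V r) :=
  memHs_timeIntegral (h.memL2L2_flux.mono hr)

theorem energy_le (h : IsIntegratedSolution Ω T s K w₀ g V w) (hK : IsEllipticKernel lam Lam K)
    (hlam : 0 ≤ lam) (hr : r ∈ Ioo 0 T) :
    2⁻¹ * (energyNorm s K (timeIntegral V r)).toReal ^ 2 ≤
      (∫ t in Ioo 0 r, bilinForm s K (timeIntegral V t) (g t)) +
        ∫ x in Ω, timeIntegral (fun t x => V t x - g t x) r x * w₀ x := by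
  have hsub : Ioo 0 r ⊆ Ioo 0 T := Ioo_subset_Ioo_right hr.2.le
  have hV := h.memL2L2_flux.mono hr.2.le
  have hg := h.memL2L2_exterior.mono hr.2.le
  have hVg : MemL2L2 r (volume.restrict Ω) fun t x => V t x - g t x :=
    (h.memL2L2_sub.mono hr.2.le).of_sobolevGraph.mono_measure
      (Measure.prod_mono le_rfl Measure.restrict_le_self)
  have hint := hK.integrableOn_bilinForm_timeIntegral hlam hV hg
  have hpair : IntegrableOn (fun t => ∫ x in Ω, (V t x - g t x) * w₀ x) (Ioo 0 r) :=
    integrable_integral_mul hVg (memLp_uncurry_const h.memLp_initial)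
  rw [← hK.integral_bilinForm_timeIntegral_self hlam hr.1.le hV,
    integral_timeIntegral_mul hVg h.memLp_initial, ← integral_add hint hpair]
  refine integral_mono_ae (hK.integrableOn_bilinForm_timeIntegral hlam hV hV) (hint.add hpair) ?_
  filter_upwards [ae_restrict_of_ae_restrict_of_subset hsub h.memHsTilde,
    ae_restrict_of_ae_restrict_of_subset hsub h.integral_mul_nonneg,
    ae_restrict_of_ae_restrict_of_subset hsub h.equation, hV.ae_memLp, hg.ae_memLp,
    ae_restrict_mem measurableSet_Ioo] with t htilde hmono heq hVt hgt ht
  have htest := heq _ htilde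
  rw [hK.bilinForm_sub_right hlam (h.memHs_timeIntegral_flux (ht.2.trans hr.2).le)
    (memHs_iff_memLp.2 hVt) (memHs_iff_memLp.2 hgt)] at htest
  simp only [mul_comm _ (w₀ _)]
  linarith

theorem abs_integral_bilinForm_le (h : IsIntegratedSolution Ω T s K w₀ g V w)
    (hK : IsEllipticKernel lam Lam K) (hlam : 0 ≤ lam) (hr : r ≤ T) {S : ℝ}
    (hS : ∀ t ∈ Ioo 0 T, (energyNorm s K (timeIntegral V t)).toReal ≤ S) :
    |∫ t in Ioo 0 r, bilinForm s K (timeIntegral V t) (g t)| ≤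
      S * (√Lam * (l1HsNorm T s g).toReal) := by
  have hLam := hK.upper_nonneg hlam
  rw [← Real.norm_eq_abs, ← h.memL2L2_exterior.integral_toReal_hsNorm, ← integral_const_mul,
    ← integral_const_mul]
  have hint := (h.memL2L2_exterior.integrableOn_toReal_hsNorm.const_mul √Lam).const_mul S
  have hnonneg : ∀ᵐ t ∂volume.restrict (Ioo 0 T), 0 ≤ S * (√Lam * (hsNorm s (g t)).toReal) := by
    filter_upwards [ae_restrict_mem measurableSet_Ioo] with t ht
    exact mul_nonneg (ENNReal.toReal_nonneg.trans (hS t ht)) (by positivity)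
  have hsub : Ioo 0 r ⊆ Ioo 0 T := Ioo_subset_Ioo_right hr
  refine (norm_integral_le_of_norm_le (IntegrableOn.mono_set hint hsub) ?_).trans
    (setIntegral_mono_set hint hnonneg hsub.eventuallyLE)
  filter_upwards [(h.memL2L2_exterior.mono hr).ae_memLp, ae_restrict_mem measurableSet_Ioo]
    with t hgt ht
  have hgt : MemHs s (g t) := memHs_iff_memLp.2 hgt
  exact (hK.abs_bilinForm_le hlam (h.memHs_timeIntegral_flux (hsub ht).2.le) hgt).trans
    (mul_le_mul (hS t (hsub ht)) (hK.toReal_energyNorm_le hLam hgt) ENNReal.toReal_nonneg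
      (ENNReal.toReal_nonneg.trans (hS t (hsub ht))))

theorem energyNorm_timeIntegral_exterior_le (h : IsIntegratedSolution Ω T s K w₀ g V w)
    (hK : IsEllipticKernel lam Lam K) (hLam : 0 ≤ Lam) (hr : r ≤ T) :
    (energyNorm s K (timeIntegral g r)).toReal ≤ √Lam * (l1HsNorm T s g).toReal := by
  refine (hK.toReal_energyNorm_le hLam
    (memHs_timeIntegral (h.memL2L2_exterior.mono hr))).trans ?_
  gcongr
  · exact h.memL2L2_exterior.l1HsNorm_lt_top.ne
  · exact hsNorm_timeIntegral_le hr h.memL2L2_exterior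

theorem hsNorm_timeIntegral_sub_le (h : IsIntegratedSolution Ω T s K w₀ g V w)
    (hK : IsEllipticKernel lam Lam K) (hLam : 0 ≤ Lam) (hP : 0 ≤ P)
    (hpoincare : ∀ f, MemHsTilde Ω s f → hsNorm s f ≤ ENNReal.ofReal P * energyNorm s K f)
    (hr : r ≤ T) :
    (hsNorm s (timeIntegral (fun t x => V t x - g t x) r)).toReal ≤
      P * ((energyNorm s K (timeIntegral V r)).toReal + √Lam * (l1HsNorm T s g).toReal) := by
  have hU := h.memHs_timeIntegral_flux hr
  have hG := memHs_timeIntegral (h.memL2L2_exterior.mono hr)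
  have hW := h.memHsTilde_timeIntegral hr
  have hdiff := (h.memL2L2_flux.of_sobolevGraph.mono hr).timeIntegral_sub
    (h.memL2L2_exterior.of_sobolevGraph.mono hr)
  have henergy := (energyNorm_congr_ae (s := s) (K := K) hdiff).trans_le
    (hK.energyNorm_sub_le hU hG)
  calc (hsNorm s (timeIntegral (fun t x => V t x - g t x) r)).toReal
      ≤ (ENNReal.ofReal P *
          (energyNorm s K (timeIntegral V r) + energyNorm s K (timeIntegral g r))).toReal := by
        refine ENNReal.toReal_mono ?_ ((hpoincare _ hW).trans (by gcongr))
        exact ENNReal.mul_ne_top ENNReal.ofReal_ne_top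
          (ENNReal.add_ne_top.2 ⟨(hK.energyNorm_lt_top hU).ne, (hK.energyNorm_lt_top hG).ne⟩)
    _ = P * ((energyNorm s K (timeIntegral V r)).toReal +
          (energyNorm s K (timeIntegral g r)).toReal) := by
        rw [ENNReal.toReal_mul, ENNReal.toReal_ofReal hP, ENNReal.toReal_add
          (hK.energyNorm_lt_top hU).ne (hK.energyNorm_lt_top hG).ne]
    _ ≤ _ := by
        gcongr
        exact h.energyNorm_timeIntegral_exterior_le hK hLam hr

theorem toReal_energyNorm_timeIntegral_le (h : IsIntegratedSolution Ω T s K w₀ g V w)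
    (hK : IsEllipticKernel lam Lam K) (hlam : 0 ≤ lam) (hP : 0 ≤ P)
    (hpoincare : ∀ f, MemHsTilde Ω s f → hsNorm s f ≤ ENNReal.ofReal P * energyNorm s K f)
    (hr : r ∈ Ioo 0 T) :
    (energyNorm s K (timeIntegral V r)).toReal ≤
      3 * (P * (hNegNorm Ω s w₀).toReal + √Lam * (l1HsNorm T s g).toReal) := by
  have hLam := hK.upper_nonneg hlam
  set ν := (hNegNorm Ω s w₀).toReal
  set γ := √Lam * (l1HsNorm T s g).toReal
  have hν : 0 ≤ P * ν := by positivity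
  have hγ : 0 ≤ γ := by positivity
  have hbdd : BddAbove (range fun t : Ioo 0 T => (energyNorm s K (timeIntegral V t)).toReal) := by
    refine ⟨(∫⁻ t in Ioo 0 T, energyNorm s K (V t)).toReal, forall_mem_range.2 fun t => ?_⟩
    exact ENNReal.toReal_mono (hK.lintegral_energyNorm_lt_top h.memL2L2_flux).ne
      (hK.energyNorm_timeIntegral_le t.2.2.le h.memL2L2_flux)
  refine le_three_mul_of_forall_sq_le (add_nonneg hν hγ) (fun t => ENNReal.toReal_nonneg) hbdd
    (fun S hS t => ?_) ⟨r, hr⟩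
  have henergy := h.energy_le hK hlam t.2
  have hexterior := (abs_le.1 (h.abs_integral_bilinForm_le hK hlam t.2.2.le
    fun τ hτ => hS ⟨τ, hτ⟩)).2
  have hinitial : ∫ x in Ω, timeIntegral (fun t x => V t x - g t x) t x * w₀ x ≤
      P * ν * (S + γ) := by
    simp only [mul_comm _ (w₀ _)]
    calc _ ≤ ν * (hsNorm s (timeIntegral (fun t x => V t x - g t x) t)).toReal :=
          (le_abs_self _).trans (abs_integral_le_hNegNorm_mul_hsNorm h.memLp_initial
            (h.memHsTilde_timeIntegral t.2.2.le))
      _ ≤ ν * (P * (S + γ)) := by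
          gcongr
          refine (h.hsNorm_timeIntegral_sub_le hK hLam hP hpoincare t.2.2.le).trans ?_
          gcongr
          exact hS t
      _ = P * ν * (S + γ) := by ring
  nlinarith

theorem ae_hNegNorm_le (h : IsIntegratedSolution Ω T s K w₀ g V w)
    (hK : IsEllipticKernel lam Lam K) (hlam : 0 ≤ lam) {S : ℝ} (hS₀ : 0 ≤ S)
    (hS : ∀ t ∈ Ioo 0 T, (energyNorm s K (timeIntegral V t)).toReal ≤ S) :
    ∀ᵐ t ∂volume.restrict (Ioo 0 T),
      hNegNorm Ω s (w t) ≤ ENNReal.ofReal ((hNegNorm Ω s w₀).toReal + √Lam * S) := by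
  have hLam := hK.upper_nonneg hlam
  filter_upwards [h.equation, h.memL2L2.ae_memLp, ae_restrict_mem measurableSet_Ioo]
    with t heq hwt ht
  refine hNegNorm_le hwt fun f hf hf₁ => ENNReal.ofReal_le_ofReal ?_
  have hf₁ : (hsNorm s f).toReal ≤ 1 :=
    ENNReal.toReal_le_of_le_ofReal zero_le_one (hf₁.trans_eq ENNReal.ofReal_one.symm)
  have hinitial : |∫ x in Ω, w₀ x * f x| ≤ (hNegNorm Ω s w₀).toReal :=
    (abs_integral_le_hNegNorm_mul_hsNorm h.memLp_initial hf).trans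
      (mul_le_of_le_one_right ENNReal.toReal_nonneg hf₁)
  have hflux : |bilinForm s K (timeIntegral V t) f| ≤ S * √Lam :=
    (hK.abs_bilinForm_le hlam (h.memHs_timeIntegral_flux ht.2.le) hf.1).trans
      (mul_le_mul (hS t ht) ((hK.toReal_energyNorm_le hLam hf.1).trans
        (mul_le_of_le_one_right (Real.sqrt_nonneg Lam) hf₁)) ENNReal.toReal_nonneg hS₀)
  calc |∫ x in Ω, w t x * f x|
      = |(∫ x in Ω, w₀ x * f x) - bilinForm s K (timeIntegral V t) f| := by
        rw [← heq f hf, add_sub_cancel_right]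
    _ ≤ (hNegNorm Ω s w₀).toReal + √Lam * S := by
        linarith [abs_sub (∫ x in Ω, w₀ x * f x) (bilinForm s K (timeIntegral V t) f)]

theorem hsNorm_timeIntegral_flux_le (h : IsIntegratedSolution Ω T s K w₀ g V w)
    (hK : IsEllipticKernel lam Lam K) (hLam : 0 ≤ Lam) (hP : 0 ≤ P)
    (hpoincare : ∀ f, MemHsTilde Ω s f → hsNorm s f ≤ ENNReal.ofReal P * energyNorm s K f)
    (hr : r ≤ T) {S : ℝ} (hS : (energyNorm s K (timeIntegral V r)).toReal ≤ S) :
    hsNorm s (timeIntegral V r) ≤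
      ENNReal.ofReal (P * (S + √Lam * (l1HsNorm T s g).toReal) + (l1HsNorm T s g).toReal) := by
  have hdiff := (h.memL2L2_flux.of_sobolevGraph.mono hr).timeIntegral_sub
    (h.memL2L2_exterior.of_sobolevGraph.mono hr)
  refine (hsNorm_le_add_hsNorm_sub (h.memHs_timeIntegral_flux hr)
    (memHs_timeIntegral (h.memL2L2_exterior.mono hr))).trans ?_
  rw [← hsNorm_congr_ae hdiff, ENNReal.ofReal_add
    (mul_nonneg hP (add_nonneg (ENNReal.toReal_nonneg.trans hS) (by positivity)))
    ENNReal.toReal_nonneg, ENNReal.ofReal_toReal h.memL2L2_exterior.l1HsNorm_lt_top.ne]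
  refine add_le_add ?_ (hsNorm_timeIntegral_le hr h.memL2L2_exterior)
  rw [← ENNReal.ofReal_toReal (h.memHsTilde_timeIntegral hr).1.hsNorm_lt_top.ne]
  refine ENNReal.ofReal_le_ofReal ((h.hsNorm_timeIntegral_sub_le hK hLam hP hpoincare hr).trans ?_)
  gcongr

theorem lInfty_add_lInfty_le (h : IsIntegratedSolution Ω T s K w₀ g V w)
    (hK : IsEllipticKernel lam Lam K) (hlam : 0 ≤ lam) (hP : 0 ≤ P)
    (hpoincare : ∀ f, MemHsTilde Ω s f → hsNorm s f ≤ ENNReal.ofReal P * energyNorm s K f) :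
    lInftyHNegNorm Ω T s w + lInftyHsNorm T s (timeIntegral V) ≤
      ENNReal.ofReal (1 + 4 * (√Lam + P) ^ 2) *
        (hNegNorm Ω s w₀ + l1HsNorm T s g) := by
  have hLam := hK.upper_nonneg hlam
  set ν := (hNegNorm Ω s w₀).toReal with hν
  set γ := (l1HsNorm T s g).toReal with hγ
  set S := 3 * (P * ν + √Lam * γ) with hS
  have henergy : ∀ t ∈ Ioo 0 T, (energyNorm s K (timeIntegral V t)).toReal ≤ S := fun t ht =>
    h.toReal_energyNorm_timeIntegral_le hK hlam hP hpoincare ht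
  have hdual : ∀ᵐ t ∂volume.restrict (Ioo 0 T), hNegNorm Ω s (w t) ≤ .ofReal (ν + √Lam * S) :=
    h.ae_hNegNorm_le hK hlam (by positivity) henergy
  have hflux : ∀ᵐ t ∂volume.restrict (Ioo 0 T), hsNorm s (timeIntegral V t) ≤
      .ofReal (P * (S + √Lam * γ) + γ) := by
    filter_upwards [ae_restrict_mem measurableSet_Ioo] with t ht
    exact h.hsNorm_timeIntegral_flux_le hK hLam hP hpoincare ht.2.le (henergy t ht)
  refine (add_le_add (essSup_le_of_ae_le _ hdual) (essSup_le_of_ae_le _ hflux)).trans ?_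
  rw [← ENNReal.ofReal_toReal (hNegNorm_lt_top h.memLp_initial).ne,
    ← ENNReal.ofReal_toReal h.memL2L2_exterior.l1HsNorm_lt_top.ne, ← hν, ← hγ,
    ← ENNReal.ofReal_add (by positivity) (by positivity),
    ← ENNReal.ofReal_add (by positivity) (by positivity), ← ENNReal.ofReal_mul (by positivity)]
  refine ENNReal.ofReal_le_ofReal ?_
  have hgap : 0 ≤ ν * (4 * √Lam ^ 2 + 5 * √Lam * P + P ^ 2) + γ * (√Lam + 2 * P) ^ 2 := by
    positivity
  rw [hS]
  linarith

end IsIntegratedSolution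

end Stability

section Comparison

variable {n : ℕ} {s T m lam Lam : ℝ} {Ω : Set (𝔼 n)} {K : 𝔼 n → 𝔼 n → ℝ}
  {u₀ u₀₁ u₀₂ : 𝔼 n → ℝ} {φ φ₁ φ₂ u u₁ u₂ : ℝ → 𝔼 n → ℝ}

theorem memHsTilde_porousPhi_sub {a b : 𝔼 n → ℝ} (hm : 0 < m) (hΩ : MeasurableSet Ω)
    (hb : ∀ x ∈ Ω, b x = 0) (hab : MemHsTilde Ω s fun x => porousPhi m (a x - b x)) :
    MemHsTilde Ω s fun x => porousPhi m (a x) - porousPhi m (b x) := by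
  have hzero : porousPhi m 0 = 0 := by simp [porousPhi]
  refine hab.congr_ae ?_
  filter_upwards [(ae_restrict_iff' hΩ.compl).1 (hab.ae_eq_zero hΩ)] with x hx
  by_cases hxΩ : x ∈ Ω
  · rw [hb x hxΩ, hzero, sub_zero, sub_zero]
  · have hsub : a x - b x = 0 := (strictMono_porousPhi hm).injective ((hx hxΩ).trans hzero.symm)
    rw [hsub, hzero, sub_eq_zero.1 hsub, sub_self]

theorem ae_eq_of_integral_mul_porousPhi_sub_eq_zero {a b : 𝔼 n → ℝ} (hm : 0 < m)
    (hΩ : MeasurableSet Ω) (hab : MemLp (fun x => a x - b x) 2 (volume.restrict Ω))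
    (hΦ : MemHsTilde Ω s fun x => porousPhi m (a x) - porousPhi m (b x))
    (h : ∫ x in Ω, (a x - b x) * (porousPhi m (a x) - porousPhi m (b x)) = 0) :
    a =ᵐ[volume] b := by
  have hinj := (strictMono_porousPhi hm).injective
  refine ae_of_ae_restrict_of_ae_restrict_compl Ω ?_ ?_
  · have hprod := (integral_eq_zero_iff_of_nonneg
      (fun x => sub_mul_porousPhi_sub_nonneg hm (a x) (b x))
      (hab.integrable_mul (hΦ.1.1.restrict Ω))).1 h
    filter_upwards [hprod] with x hx
    rcases mul_eq_zero.1 hx with hx | hx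
    · exact sub_eq_zero.1 hx
    · exact hinj (sub_eq_zero.1 hx)
  · filter_upwards [hΦ.ae_eq_zero hΩ] with x hx using hinj (sub_eq_zero.1 hx)

theorem IsWeakSolution.isIntegratedSolution_sub (h₁ : IsWeakSolution Ω T s m K u₀₁ φ₁ u₁)
    (h₂ : IsWeakSolution Ω T s m K u₀₂ φ₂ u₂) (hT : 0 < T) (hm : 1 ≤ m) (hΩ : MeasurableSet Ω)
    (hΩb : Bornology.IsBounded Ω) (hK : IsEllipticKernel lam Lam K) (hlam : 0 ≤ lam)
    (hu₀₁ : MemLp u₀₁ 2 (volume.restrict Ω)) (hu₀₂ : MemLp u₀₂ 2 (volume.restrict Ω))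
    (hφ₁Ω : ∀ t ∈ Ioo 0 T, ∀ x ∈ Ω, φ₁ t x = 0) (hφ₂Ω : ∀ t ∈ Ioo 0 T, ∀ x ∈ Ω, φ₂ t x = 0)
    (hφ₁ : MemL2Hs T s fun t x => porousPhi m (φ₁ t x))
    (hφ₂ : MemL2Hs T s fun t x => porousPhi m (φ₂ t x)) :
    IsIntegratedSolution Ω T s K (fun x => u₀₁ x - u₀₂ x)
      (fun t x => porousPhi m (φ₁ t x) - porousPhi m (φ₂ t x))
      (fun t x => porousPhi m (u₁ t x) - porousPhi m (u₂ t x)) (fun t x => u₁ t x - u₂ t x) where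
  memL2L2_flux := h₁.memL2Hs.memL2L2_sobolevGraph.sobolevGraph_sub
    h₂.memL2Hs.memL2L2_sobolevGraph
  memL2L2_exterior := hφ₁.memL2L2_sobolevGraph.sobolevGraph_sub hφ₂.memL2L2_sobolevGraph
  memL2L2 := MemLp.sub (h₁.memL2L2 hm hΩb) (h₂.memL2L2 hm hΩb)
  memLp_initial := hu₀₁.sub hu₀₂
  memHsTilde := by
    have hm₀ : 0 < m := zero_lt_one.trans_le hm
    filter_upwards [h₁.exterior.2, h₂.exterior.2, ae_restrict_mem measurableSet_Ioo]
      with t h₁t h₂t ht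
    exact ((memHsTilde_porousPhi_sub hm₀ hΩ (hφ₁Ω t ht) h₁t).sub
      (memHsTilde_porousPhi_sub hm₀ hΩ (hφ₂Ω t ht) h₂t)).congr_ae
      (.of_forall fun x => sub_sub_sub_comm _ _ _ _)
  integral_mul_nonneg := by
    filter_upwards [ae_restrict_mem measurableSet_Ioo] with t ht
    refine setIntegral_nonneg hΩ fun x hx => ?_
    rw [hφ₁Ω t ht x hx, hφ₂Ω t ht x hx, sub_self, sub_zero]
    exact sub_mul_porousPhi_sub_nonneg (zero_lt_one.trans_le hm) _ _
  equation := by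
    filter_upwards [
      h₁.ae_forall_integral_add_bilinForm_eq (h₁.memL2L2 hm hΩb) hT hΩ hK hlam hu₀₁,
      h₂.ae_forall_integral_add_bilinForm_eq (h₂.memL2L2 hm hΩb) hT hΩ hK hlam hu₀₂,
      (h₁.memL2L2 hm hΩb).ae_memLp, (h₂.memL2L2 hm hΩb).ae_memLp,
      ae_restrict_mem measurableSet_Ioo] with t heq₁ heq₂ hu₁t hu₂t ht f hf
    have hfΩ := hf.1.1.restrict Ω
    have hbilin := hK.bilinForm_timeIntegral_sub hlam
      (h₁.memL2Hs.memL2L2_sobolevGraph.mono ht.2.le)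
      (h₂.memL2Hs.memL2L2_sobolevGraph.mono ht.2.le) hf.1
    have h₁f : _ + bilinForm s K (timeIntegral (fun t x => porousPhi m (u₁ t x)) t) f = _ :=
      heq₁ f hf
    have h₂f : _ + bilinForm s K (timeIntegral (fun t x => porousPhi m (u₂ t x)) t) f = _ :=
      heq₂ f hf
    rw [integral_sub_mul_of_memLp_two hu₁t hu₂t hfΩ,
      integral_sub_mul_of_memLp_two hu₀₁ hu₀₂ hfΩ, hbilin]
    linarith

theorem IsIntegratedSolution.ae_integral_mul_eq_zero {w₀ : 𝔼 n → ℝ} {g V w : ℝ → 𝔼 n → ℝ}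
    (h : IsIntegratedSolution Ω T s K w₀ g V w) (hw : lInftyHNegNorm Ω T s w = 0) :
    ∀ᵐ t ∂volume.restrict (Ioo 0 T), ∫ x in Ω, w t x * (V t x - g t x) = 0 := by
  filter_upwards [ENNReal.ae_le_essSup (μ := volume.restrict (Ioo 0 T)) fun t =>
    hNegNorm Ω s (w t), h.memL2L2.ae_memLp, h.memHsTilde] with t hnorm hwt hVg
  have hnorm : hNegNorm Ω s (w t) = 0 := le_antisymm (hnorm.trans_eq hw) zero_le
  have hle := abs_integral_le_hNegNorm_mul_hsNorm hwt hVg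
  rw [hnorm, ENNReal.toReal_zero, zero_mul] at hle
  exact abs_nonpos_iff.1 hle

theorem IsWeakSolution.lInftyHsNorm_timePrimitive_sub
    (h₁ : IsWeakSolution Ω T s m K u₀₁ φ₁ u₁) (h₂ : IsWeakSolution Ω T s m K u₀₂ φ₂ u₂) :
    lInftyHsNorm T s (fun t x => timePrimitive m u₁ t x - timePrimitive m u₂ t x) =
      lInftyHsNorm T s (timeIntegral fun t x => porousPhi m (u₁ t x) - porousPhi m (u₂ t x)) := by
  refine essSup_congr_ae ?_
  filter_upwards [ae_restrict_mem measurableSet_Ioo] with t ht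
  exact (hsNorm_congr_ae ((h₁.memL2Hs.memL2L2_sobolevGraph.of_sobolevGraph.mono
    ht.2.le).timeIntegral_sub
      (h₂.memL2Hs.memL2L2_sobolevGraph.of_sobolevGraph.mono ht.2.le))).symm

theorem hNegNorm_zero : hNegNorm Ω s (fun _ => 0) = 0 := by
  simp [hNegNorm]

theorem l1HsNorm_zero : l1HsNorm T s (fun _ (_ : 𝔼 n) => 0) = 0 := by
  simp [l1HsNorm, hsNorm, gagliardoSq]

theorem IsWeakSolution.aestronglyMeasurable (hu : IsWeakSolution Ω T s m K u₀ φ u) (hm : m ≠ 0) :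
    AEStronglyMeasurable (Function.uncurry u) ((volume.restrict (Ioo 0 T)).prod volume) :=
  aestronglyMeasurable_of_porousPhi hm hu.memL2Hs.1

theorem IsWeakSolution.ae_eq_of_lInftyHNegNorm_sub_eq_zero
    (h₁ : IsWeakSolution Ω T s m K u₀ φ u₁) (h₂ : IsWeakSolution Ω T s m K u₀ φ u₂) (hm : 1 ≤ m)
    (hΩ : MeasurableSet Ω) (h : IsIntegratedSolution Ω T s K (fun x => u₀ x - u₀ x)
      (fun t x => porousPhi m (φ t x) - porousPhi m (φ t x))
      (fun t x => porousPhi m (u₁ t x) - porousPhi m (u₂ t x)) (fun t x => u₁ t x - u₂ t x))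
    (hnorm : lInftyHNegNorm Ω T s (fun t x => u₁ t x - u₂ t x) = 0) :
    ∀ᵐ p ∂((volume.restrict (Ioo (0 : ℝ) T)).prod volume), u₁ p.1 p.2 = u₂ p.1 p.2 := by
  have hm₀ : 0 < m := zero_lt_one.trans_le hm
  refine ae_prod_eq_of_ae_ae_eq (h₁.aestronglyMeasurable hm₀.ne')
    (h₂.aestronglyMeasurable hm₀.ne') ?_
  filter_upwards [h.ae_integral_mul_eq_zero hnorm, h.memL2L2.ae_memLp, h.memHsTilde]
    with t hzero hwt hΦ
  simp only [sub_self, sub_zero] at hzero hΦ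
  exact ae_eq_of_integral_mul_porousPhi_sub_eq_zero hm₀ hΩ hwt hΦ hzero

theorem IsExteriorDatum.eq_zero (hφ : IsExteriorDatum Ω T s m φ) {t : ℝ} (ht : t ∈ Icc 0 T)
    {x : 𝔼 n} (hx : x ∈ Ω) : φ t x = 0 := by
  obtain ⟨S, -, hS, hzero⟩ := hφ.compact_support
  exact hzero t ht x fun hmem => (hS hmem).2 (subset_closure hx)

end Comparison

theorem mainTheorem7_general {n : ℕ} [Nonempty (Fin n)] {Ω : Set (𝔼 n)} (hΩ : MeasurableSet Ω)
    (hΩb : Bornology.IsBounded Ω) {T s m lam : ℝ} (hT : 0 < T) (hs : 0 ≤ (n : ℝ) + 2 * s)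
    (hm : 1 ≤ m) (hlam : 0 < lam) (Lam : ℝ) :
    (∃ C : ℝ, 0 < C ∧ ∀ K, IsEllipticKernel lam Lam K →
      ∀ u₀₁ u₀₂, MemLp u₀₁ 2 (volume.restrict Ω) → MemLp u₀₂ 2 (volume.restrict Ω) →
      ∀ φ₁ φ₂ : ℝ → 𝔼 n → ℝ, (∀ t ∈ Ioo 0 T, ∀ x ∈ Ω, φ₁ t x = 0) →
        (∀ t ∈ Ioo 0 T, ∀ x ∈ Ω, φ₂ t x = 0) →
        MemL2Hs T s (fun t x => porousPhi m (φ₁ t x)) →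
        MemL2Hs T s (fun t x => porousPhi m (φ₂ t x)) →
      ∀ u₁ u₂, IsWeakSolution Ω T s m K u₀₁ φ₁ u₁ → IsWeakSolution Ω T s m K u₀₂ φ₂ u₂ →
        lInftyHNegNorm Ω T s (fun t x => u₁ t x - u₂ t x) +
            lInftyHsNorm T s (fun t x => timePrimitive m u₁ t x - timePrimitive m u₂ t x) ≤
          ENNReal.ofReal C *
            (hNegNorm Ω s (fun x => u₀₁ x - u₀₂ x) +
              l1HsNorm T s (fun t x => porousPhi m (φ₁ t x) - porousPhi m (φ₂ t x)))) ∧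
    (∀ K, IsEllipticKernel lam Lam K → ∀ u₀, MemLp u₀ 2 (volume.restrict Ω) →
      ∀ φ : ℝ → 𝔼 n → ℝ, (∀ t ∈ Ioo 0 T, ∀ x ∈ Ω, φ t x = 0) →
        MemL2Hs T s (fun t x => porousPhi m (φ t x)) →
      ∀ u₁ u₂, IsWeakSolution Ω T s m K u₀ φ u₁ → IsWeakSolution Ω T s m K u₀ φ u₂ →
        ∀ᵐ p ∂((volume.restrict (Ioo (0 : ℝ) T)).prod volume), u₁ p.1 p.2 = u₂ p.1 p.2) := by
  obtain ⟨P, hP, hpoincare⟩ := exists_hsNorm_le_energyNorm (Lam := Lam) hs hΩb hΩ hlam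
  refine ⟨⟨1 + 4 * (√Lam + P) ^ 2, by positivity, ?_⟩, ?_⟩
  · intro K hK u₀₁ u₀₂ hu₀₁ hu₀₂ φ₁ φ₂ hφ₁Ω hφ₂Ω hφ₁ hφ₂ u₁ u₂ h₁ h₂
    rw [h₁.lInftyHsNorm_timePrimitive_sub h₂]
    exact (h₁.isIntegratedSolution_sub h₂ hT hm hΩ hΩb hK hlam.le hu₀₁ hu₀₂ hφ₁Ω hφ₂Ω hφ₁
      hφ₂).lInfty_add_lInfty_le hK hlam.le hP.le (hpoincare K hK)
  · intro K hK u₀ hu₀ φ hφΩ hφ u₁ u₂ h₁ h₂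
    have h := h₁.isIntegratedSolution_sub h₂ hT hm hΩ hΩb hK hlam.le hu₀ hu₀ hφΩ hφΩ hφ hφ
    have hstability := h.lInfty_add_lInfty_le hK hlam.le hP.le (hpoincare K hK)
    simp only [sub_self, hNegNorm_zero, l1HsNorm_zero, add_zero, mul_zero] at hstability
    exact h₁.ae_eq_of_lInftyHNegNorm_sub_eq_zero h₂ hm hΩ h
      (le_antisymm (le_self_add.trans hstability) zero_le)

theorem mainTheorem7 (n : ℕ) (hn : 1 ≤ n) (Ω : Set (EuclideanSpace ℝ (Fin n)))
    (hΩ : IsBoundedLipschitzDomain Ω) (T : ℝ) (hT : 0 < T) (s : ℝ) (hs₀ : 0 < s) (hs₁ : s < 1)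
    (m : ℝ) (hm : 1 < m) (lam Lam : ℝ) (hlam : 0 < lam) (hLam : lam ≤ Lam) :
    (∃ C : ℝ, 0 < C ∧
      ∀ K : EuclideanSpace ℝ (Fin n) → EuclideanSpace ℝ (Fin n) → ℝ,
        IsEllipticKernel lam Lam K →
      ∀ u₀₁ u₀₂ : EuclideanSpace ℝ (Fin n) → ℝ,
        IsInitialDatum Ω s u₀₁ → IsInitialDatum Ω s u₀₂ →
      ∀ φ₁ φ₂ : ℝ → EuclideanSpace ℝ (Fin n) → ℝ,
        IsExteriorDatum Ω T s m φ₁ → IsExteriorDatum Ω T s m φ₂ →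
      ∀ u₁ u₂ : ℝ → EuclideanSpace ℝ (Fin n) → ℝ,
        IsWeakSolution Ω T s m K u₀₁ φ₁ u₁ → IsWeakSolution Ω T s m K u₀₂ φ₂ u₂ →
        lInftyHNegNorm Ω T s (fun t x => u₁ t x - u₂ t x) +
            lInftyHsNorm T s (fun t x => timePrimitive m u₁ t x - timePrimitive m u₂ t x) ≤
          ENNReal.ofReal C *
            (hNegNorm Ω s (fun x => u₀₁ x - u₀₂ x) +
              l1HsNorm T s (fun t x => porousPhi m (φ₁ t x) - porousPhi m (φ₂ t x)))) ∧
    (∀ K : EuclideanSpace ℝ (Fin n) → EuclideanSpace ℝ (Fin n) → ℝ,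
        IsEllipticKernel lam Lam K →
      ∀ u₀ : EuclideanSpace ℝ (Fin n) → ℝ, IsInitialDatum Ω s u₀ →
      ∀ φ : ℝ → EuclideanSpace ℝ (Fin n) → ℝ, IsExteriorDatum Ω T s m φ →
      ∀ u₁ u₂ : ℝ → EuclideanSpace ℝ (Fin n) → ℝ,
        IsWeakSolution Ω T s m K u₀ φ u₁ → IsWeakSolution Ω T s m K u₀ φ u₂ →
        ∀ᵐ p ∂((volume.restrict (Ioo (0 : ℝ) T)).prod
            (volume : Measure (EuclideanSpace ℝ (Fin n)))), u₁ p.1 p.2 = u₂ p.1 p.2) := by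
  have : Nonempty (Fin n) := Fin.pos_iff_nonempty.1 hn
  obtain ⟨⟨C, hC, hstability⟩, hunique⟩ :=
    mainTheorem7_general (s := s) hΩ.isOpen.measurableSet hΩ.isBounded hT (by positivity) hm.le
      hlam Lam
  refine ⟨⟨C, hC, fun K hK u₀₁ u₀₂ h₀₁ h₀₂ φ₁ φ₂ hφ₁ hφ₂ => ?_⟩, fun K hK u₀ h₀ φ hφ => ?_⟩
  · exact hstability K hK u₀₁ u₀₂ (h₀₁.memHsTilde.1.1.restrict Ω) (h₀₂.memHsTilde.1.1.restrict Ω)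
      φ₁ φ₂ (fun t ht x => hφ₁.eq_zero (Ioo_subset_Icc_self ht))
      (fun t ht x => hφ₂.eq_zero (Ioo_subset_Icc_self ht)) hφ₁.memL2Hs hφ₂.memL2Hs
  · exact hunique K hK u₀ (h₀.memHsTilde.1.1.restrict Ω) φ
      (fun t ht x => hφ.eq_zero (Ioo_subset_Icc_self ht)) hφ.memL2Hs
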